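/- Let $G$ be a (finite-dimensional, second countable, Hausdorff) Lie group acting on a second countable Hausdorff finite-dimensional analytic manifold $M$ such that $g\mapsto g\cdot x$ is analytic for every $x\in M$ and $x\mapsto g\cdot x$ is analytic for every $g\in G$. For $x\in M$ let $G_x$ be the stabilizer of $x$ and $G_{[x]}=\bigcap_{g\in G}G_{g\cdot x}$. Assume that the action is regular, i.e. that every $x\in M$ is - sated: there are no two different points $y,z\in M\setminus\{x\}$ and no sequence $(g_n)\subseteq G$ with $\lim_n g_n\cdot y=x=\lim_n g_n\cdot z$; and - stable: if $(g_n)\subseteq G\setminus G_x$ and $\lim_n g_n\cdot x=x$, then $(h_n g_n h_n')$ has a convergent subsequence for some sequences $(h_n),(h_n')\subseteq G_{[x]}$. Intervals are connected subsets of $\mathbb R$ with non-empty interior. A curve $\gamma\colon D\to M$ on an interval is called analytic (analytic immersive) if it extends to an analytic map (analytic immersion) on an open interval containing $D$. A diffeomorphism $\rho\colon D\to D'$ of intervals is called analytic if it extends to an analytic diffeomorphism between open intervals. A free segment is an analytic immersive curve $\gamma\colon D\to M$ such that, for every $g\in G$: if $g\cdot\gamma(J)=\gamma(J')$ for some non-empty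 open intervals $J,J'\subseteq D$ on which $\gamma$ is an embedding, then $g\cdot\gamma=\gamma$. An analytic curve is called free if its restriction to some interval is a free segment. Let $S$ be a connected (second countable, Hausdorff) analytic $1$-manifold with (possibly empty) boundary and $\iota\colon S\to M$ an injective analytic immersion. Charts $(U,\psi)$ of $S$ are always taken with $U$ open and connected and $\iota(U)$ contained in the domain of a chart of $M$; put $\gamma_\psi=\iota\circ\psi^{-1}\colon\psi(U)\to M$. Call $(S,\iota)$ free if $\gamma_\psi$ is a free curve for some chart $(U,\psi)$. Let $G_S=\bigcap_{z\in S}G_{\iota(z)}$. Let $F$ be the set of flip points: all $z\in S$ for which there are a chart $(U,\psi)$ with $z\in U$, an analytic immersive extension $\overline{\gamma}$ of $\gamma_\psi$ to an open interval $I\supseteq\psi(U)$ (equivalently, the maximal one), an element $g\in G\setminus G_S$, an open interval $J\subseteq I$ with $\tau:=\psi(z)\in J$, and an analytic diffeomorphism $\rho\colon(-\infty,\tau]\cap J\to[\tau,\infty)\cap J$ with $\rho(\tau)=\tau$ and $g\cdot\overline{\gamma}(t)=\overline{\gamma}(\rho(t))$ for all $t\in(-\infty,\tau]\cap J$. Suppose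 that $(S,\iota)$ is free. Then $F$ is at most countable, and $F$ is empty if, in addition, the action is free (all stabilizers $G_x$ are trivial). Moreover, every $z\in S\setminus F$ has a neighbourhood $V\subseteq S$ such that $g\cdot\iota(V)\cap\iota(V)$ is finite for all $g\in G\setminus G_S$. -/

import Mathlib

open Set Filter Topology Manifold
open scoped ContDiff Pointwise

namespace AnalyticCurves

/-! ### Intervals and one-dimensional diffeomorphisms -/

/-- An interval: a connected subset of `ℝ` with non-empty interior. -/
def IsInterval (D : Set ℝ) : Prop :=
  D.OrdConnected ∧ (interior D).Nonempty

/-- A (non-empty) open interval, possibly unbounded. -/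
def IsOpenInterval (J : Set ℝ) : Prop :=
  IsOpen J ∧ J.OrdConnected ∧ J.Nonempty

/-- `ρ : D → D'` is an analytic diffeomorphism between intervals: a bijection that extends to an
analytic diffeomorphism `ρ' : I → I'` (with inverse `σ`) between open intervals. -/
def IsAnalyticDiffeo (ρ : ℝ → ℝ) (D D' : Set ℝ) : Prop :=
  BijOn ρ D D' ∧
    ∃ (ρ' σ : ℝ → ℝ) (I I' : Set ℝ), IsOpenInterval I ∧ IsOpenInterval I' ∧ D ⊆ I ∧ D' ⊆ I' ∧
      EqOn ρ' ρ D ∧ MapsTo ρ' I I' ∧ MapsTo σ I' I ∧ InvOn σ ρ' I I' ∧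
      AnalyticOnNhd ℝ ρ' I ∧ AnalyticOnNhd ℝ σ I'

/-! ### Group actions -/

/-- The stabilizer `⋂_{g ∈ G} G_{g • x}` of the orbit of `x`. -/
def orbitStabilizer (G : Type*) {M : Type*} [Group G] [MulAction G M] (x : M) : Subgroup G :=
  ⨅ g : G, MulAction.stabilizer G (g • x)

/-- The point `x` is sated: there are no two different `y, z ≠ x` and a sequence `g n` in `G`
with `g n • y → x` and `g n • z → x`. -/
def IsSated (G : Type*) {M : Type*} [Group G] [MulAction G M] [TopologicalSpace M]
    (x : M) : Prop :=
  ¬ ∃ y z : M, y ≠ x ∧ z ≠ x ∧ y ≠ z ∧ ∃ g : ℕ → G,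
    Tendsto (fun n => g n • y) atTop (𝓝 x) ∧ Tendsto (fun n => g n • z) atTop (𝓝 x)

/-- The point `x` is stable: if `g n • x → x` with all `g n` outside the stabilizer of `x`, then
`h n * g n * h' n` has a convergent subsequence for some sequences `h`, `h'` in the stabilizer of
the orbit of `x`. -/
def IsStable (G : Type*) {M : Type*} [Group G] [MulAction G M] [TopologicalSpace G]
    [TopologicalSpace M] (x : M) : Prop :=
  ∀ g : ℕ → G, (∀ n, g n ∉ MulAction.stabilizer G x) →
    Tendsto (fun n => g n • x) atTop (𝓝 x) →
    ∃ h h' : ℕ → G, (∀ n, h n ∈ orbitStabilizer G x) ∧ (∀ n, h' n ∈ orbitStabilizer G x) ∧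
      ∃ (φ : ℕ → ℕ) (a : G), StrictMono φ ∧
        Tendsto (fun n => h (φ n) * g (φ n) * h' (φ n)) atTop (𝓝 a)

/-- A regular action: every point is sated and stable. -/
def IsRegularAction (G M : Type*) [Group G] [MulAction G M] [TopologicalSpace G]
    [TopologicalSpace M] : Prop :=
  ∀ x : M, IsSated G x ∧ IsStable G x

/-- A free action: all stabilizers are trivial. -/
def IsFreeAction (G M : Type*) [Group G] [MulAction G M] : Prop :=
  ∀ x : M, MulAction.stabilizer G x = ⊥

/-- The stabilizer `G_S = ⋂_{z ∈ S} G_{ι z}` of the subset of `M` parametrized by `ι : S → M`. -/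
def imageStabilizer (G : Type*) {M S : Type*} [Group G] [MulAction G M] (ι : S → M) :
    Subgroup G :=
  ⨅ z : S, MulAction.stabilizer G (ι z)

/-- An action that is analytic separately in the group variable and in the space variable. -/
def IsAnalyticAction (F E G M : Type*) [NormedAddCommGroup F] [NormedSpace ℝ F]
    [NormedAddCommGroup E] [NormedSpace ℝ E] [TopologicalSpace G] [ChartedSpace F G]
    [TopologicalSpace M] [ChartedSpace E M] [Group G] [MulAction G M] : Prop :=
  (∀ x : M, ContMDiff 𝓘(ℝ, F) 𝓘(ℝ, E) ω (fun g : G => g • x)) ∧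
    ∀ g : G, ContMDiff 𝓘(ℝ, E) 𝓘(ℝ, E) ω (fun x : M => g • x)

/-! ### Analytic curves

A curve `γ : D → M` is given by a function `γ : ℝ → M`, only the values on `D` being relevant. -/

/-- `(δ, I)` is an analytic extension of the curve `γ : D → M` to the open interval `I`. -/
def IsAnalyticExtension (E : Type*) {M : Type*} [NormedAddCommGroup E] [NormedSpace ℝ E]
    [TopologicalSpace M] [ChartedSpace E M] (γ : ℝ → M) (D : Set ℝ) (δ : ℝ → M) (I : Set ℝ) :
    Prop :=
  IsOpenInterval I ∧ D ⊆ I ∧ EqOn δ γ D ∧ ContMDiffOn 𝓘(ℝ, ℝ) 𝓘(ℝ, E) ω δ I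

/-- `(δ, I)` is an analytic immersive extension of the curve `γ : D → M` to the open
interval `I`. -/
def IsImmersiveExtension (E : Type*) {M : Type*} [NormedAddCommGroup E] [NormedSpace ℝ E]
    [TopologicalSpace M] [ChartedSpace E M] (γ : ℝ → M) (D : Set ℝ) (δ : ℝ → M) (I : Set ℝ) :
    Prop :=
  IsAnalyticExtension E γ D δ I ∧
    ∀ t ∈ I, Function.Injective (mfderiv 𝓘(ℝ, ℝ) 𝓘(ℝ, E) δ t)

/-- `γ : D → M` is an analytic curve. -/
def IsAnalyticCurve (E : Type*) {M : Type*} [NormedAddCommGroup E] [NormedSpace ℝ E]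
    [TopologicalSpace M] [ChartedSpace E M] (γ : ℝ → M) (D : Set ℝ) : Prop :=
  IsInterval D ∧ ∃ (δ : ℝ → M) (I : Set ℝ), IsAnalyticExtension E γ D δ I

/-- `γ : D → M` is an analytic immersive curve. -/
def IsImmersiveCurve (E : Type*) {M : Type*} [NormedAddCommGroup E] [NormedSpace ℝ E]
    [TopologicalSpace M] [ChartedSpace E M] (γ : ℝ → M) (D : Set ℝ) : Prop :=
  IsInterval D ∧ ∃ (δ : ℝ → M) (I : Set ℝ), IsImmersiveExtension E γ D δ I

/-- The curves `γ : D → M` and `γ' : D' → M` overlap: `γ(J) = γ'(J')` for non-empty open intervals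
`J ⊆ D`, `J' ⊆ D'` on which `γ` and `γ'` are embeddings, respectively. (For analytic immersive
curves restricted to open intervals, this is being a topological embedding.) -/
def Overlap {M : Type*} [TopologicalSpace M] (γ : ℝ → M) (D : Set ℝ) (γ' : ℝ → M)
    (D' : Set ℝ) : Prop :=
  ∃ J J' : Set ℝ, IsOpenInterval J ∧ IsOpenInterval J' ∧ J ⊆ D ∧ J' ⊆ D' ∧
    IsEmbedding (J.domRestrict γ) ∧ IsEmbedding (J'.domRestrict γ') ∧ γ '' J = γ' '' J'

/-- `γ = γ' ∘ ρ` for some analytic diffeomorphism `ρ : D → D'` with `ρ t = t'`. -/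
def ReparamAt {M : Type*} (γ : ℝ → M) (D : Set ℝ) (γ' : ℝ → M) (D' : Set ℝ) (t t' : ℝ) : Prop :=
  t ∈ D ∧ t' ∈ D' ∧ ∃ ρ : ℝ → ℝ, IsAnalyticDiffeo ρ D D' ∧ ρ t = t' ∧ ∀ s ∈ D, γ s = γ' (ρ s)

/-- `γ : D → M` is a free segment: an analytic immersive curve such that each translate of it
overlapping it coincides with it. -/
def IsFreeSegment (G E : Type*) {M : Type*} [Group G] [NormedAddCommGroup E] [NormedSpace ℝ E]
    [TopologicalSpace M] [ChartedSpace E M] [MulAction G M] (γ : ℝ → M) (D : Set ℝ) : Prop :=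
  IsImmersiveCurve E γ D ∧
    ∀ g : G, Overlap (fun t => g • γ t) D γ D → ∀ t ∈ D, g • γ t = γ t

/-- `γ : D → M` is a free curve: an analytic curve that restricts to a free segment on some
interval `D' ⊆ D`. -/
def IsFreeCurve (G E : Type*) {M : Type*} [Group G] [NormedAddCommGroup E] [NormedSpace ℝ E]
    [TopologicalSpace M] [ChartedSpace E M] [MulAction G M] (γ : ℝ → M) (D : Set ℝ) : Prop :=
  IsAnalyticCurve E γ D ∧ ∃ D' ⊆ D, IsInterval D' ∧ IsFreeSegment G E γ D'

/-! ### One-dimensional submanifolds with boundary -/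

section Submanifold

variable {S : Type*} [TopologicalSpace S]

/-- The real coordinate `ψ(z)` of `z` in a chart `ψ` of a 1-manifold with boundary. -/
noncomputable def chartCoord (ψ : OpenPartialHomeomorph S (EuclideanHalfSpace 1)) (z : S) : ℝ :=
  (ψ z).1 0

/-- The image `ψ(U) ⊆ ℝ` of a chart `(U, ψ)`. -/
noncomputable def chartRange (ψ : OpenPartialHomeomorph S (EuclideanHalfSpace 1)) : Set ℝ :=
  chartCoord ψ '' ψ.source

/-- The curve `γ_ψ = ι ∘ ψ⁻¹` on `ψ(U)`. -/
noncomputable def chartCurve {M : Type*} (ι : S → M)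
    (ψ : OpenPartialHomeomorph S (EuclideanHalfSpace 1)) : ℝ → M :=
  fun t => ι ((ψ.extend (𝓡∂ 1)).symm !₂[t])

/-- The coordinate, its inverse and `γ_ψ` match: `γ_ψ (ψ z) = ι z` on the chart domain. -/
theorem chartCurve_chartCoord {M : Type*} (ι : S → M)
    (ψ : OpenPartialHomeomorph S (EuclideanHalfSpace 1)) {z : S} (hz : z ∈ ψ.source) :
    chartCurve ι ψ (chartCoord ψ z) = ι z := by
  have h : (!₂[chartCoord ψ z] : EuclideanSpace ℝ (Fin 1)) = ψ.extend (𝓡∂ 1) z := by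
    ext i
    fin_cases i
    rfl
  unfold chartCurve
  rw [h, ψ.extend_left_inv hz]

/-- `ι : S → M` is an injective analytic immersion of a 1-manifold with boundary. -/
def IsInjectiveImmersion (E : Type*) {M : Type*} [NormedAddCommGroup E] [NormedSpace ℝ E]
    [TopologicalSpace M] [ChartedSpace E M] [ChartedSpace (EuclideanHalfSpace 1) S]
    (ι : S → M) : Prop :=
  Function.Injective ι ∧ ContMDiff (𝓡∂ 1) 𝓘(ℝ, E) ω ι ∧
    ∀ z : S, Function.Injective (mfderiv (𝓡∂ 1) 𝓘(ℝ, E) ι z)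

/-- The charts `(U, ψ)` of `S` that are considered: members of the maximal analytic atlas with
connected domain `U` such that `ι(U)` is contained in the domain of some chart of `M`. -/
def IsAdmissibleChart (E : Type*) {M : Type*} [NormedAddCommGroup E] [NormedSpace ℝ E]
    [TopologicalSpace M] [ChartedSpace E M] [ChartedSpace (EuclideanHalfSpace 1) S]
    (ι : S → M) (ψ : OpenPartialHomeomorph S (EuclideanHalfSpace 1)) : Prop :=
  ψ ∈ IsManifold.maximalAtlas (𝓡∂ 1) ω S ∧ IsConnected ψ.source ∧
    ∃ χ ∈ IsManifold.maximalAtlas 𝓘(ℝ, E) ω M, ι '' ψ.source ⊆ χ.source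

/-- `(S, ι)` is free: `γ_ψ` is a free curve for some chart `ψ`. -/
def IsFreeSubmanifold (G E : Type*) {M : Type*} [Group G] [NormedAddCommGroup E]
    [NormedSpace ℝ E] [TopologicalSpace M] [ChartedSpace E M] [MulAction G M]
    [ChartedSpace (EuclideanHalfSpace 1) S] (ι : S → M) : Prop :=
  ∃ ψ : OpenPartialHomeomorph S (EuclideanHalfSpace 1),
    IsAdmissibleChart E ι ψ ∧ IsFreeCurve G E (chartCurve ι ψ) (chartRange ψ)

/-- The set of flip points of `(S, ι)`: those `z` for which, in some chart `(U, ψ)` around `z`, some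
`g` outside the stabilizer of `S` maps the part of the curve `δ` to the left of `ψ(z)` onto the part
to the right of `ψ(z)`, fixing the point itself, after restriction to some open interval `J`
around `ψ(z)`. Here `δ` is the analytic immersive extension of `γ_ψ` beyond `ψ(U)` (which matters
if `z` is a boundary point). Any extension may be used in place of the maximal one, as all of them
are restrictions of the latter and `J` can be any open interval in its domain. -/
def flipPoints (G E : Type*) {M : Type*} [Group G] [NormedAddCommGroup E]
    [NormedSpace ℝ E] [TopologicalSpace M] [ChartedSpace E M] [MulAction G M]
    [ChartedSpace (EuclideanHalfSpace 1) S] (ι : S → M) : Set S :=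
  {z | ∃ ψ : OpenPartialHomeomorph S (EuclideanHalfSpace 1),
    IsAdmissibleChart E ι ψ ∧ z ∈ ψ.source ∧
    ∃ (δ : ℝ → M) (I : Set ℝ), IsImmersiveExtension E (chartCurve ι ψ) (chartRange ψ) δ I ∧
    ∃ g : G, g ∉ imageStabilizer G ι ∧
    ∃ J : Set ℝ, IsOpenInterval J ∧ J ⊆ I ∧ chartCoord ψ z ∈ J ∧
      ReparamAt (fun t => g • δ t) (Iic (chartCoord ψ z) ∩ J) δ (Ici (chartCoord ψ z) ∩ J)
        (chartCoord ψ z) (chartCoord ψ z)}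

end Submanifold

end AnalyticCurves

namespace AnalyticCurves

/-! ### Analytic curves in a manifold -/

section Curves

variable {E M : Type*} [NormedAddCommGroup E] [NormedSpace ℝ E]
  [TopologicalSpace M] [ChartedSpace E M]

/-! Around a point w of S, the immersion is replaced by a short injective analytic immersive curve γ
on [-a, a], which extends past w even if w is a boundary point. A group element g is then studied
through its transition map f = γ⁻¹ ∘ g ∘ γ. By the identity theorem, f is defined and analytic near
each accumulation point of its domain, as long as the point and its image are interior
(`IsTransCurve.analyticAt_map`).

Satedness supplies uniformity. If g brings γ back to itself infinitely often close enough to the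
centre, then f lives on a neighbourhood of the centre that does not depend on g
(`IsOpenTransCurve.exists_radius`), and it is strictly monotone there. An increasing f with an
almost fixed point is close to the identity: otherwise it would push points by a definite amount,
and iterating g⁻¹ would bring two fixed distinct points of the curve arbitrarily close to a third
one (`IsTransCurve.exists_no_push`). So increasing transition maps with almost fixed points that
concentrate at the centre converge to the identity. This convergence spreads over the connected S
(`convergesAt_of_eventually`) and reaches the part of S that contains a free segment, where
infinitely many returns force g into G_S (`IsFreeSubmanifold.exists_nhds`).

Hence, close enough to w, elements outside G_S have decreasing transition maps. The composition of
two such maps is increasing, so the product of two such elements lies in G_S. Therefore all of them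
act on γ in the same way, by a single decreasing f (`IsChartCurve.exists_unique_transition`). A flip
point near w is a fixed point of f, and a decreasing map has at most one; flip points are thus
locally unique, hence countable. If arbitrarily small neighbourhoods of w return to themselves
infinitely often under elements outside G_S, then f fixes the centre, and a decreasing f fixing the
centre exhibits w as a flip point (`mem_flipPoints`). -/

/-- The curve `γ` is analytic and immersive at `t`. -/
def IsImmersedAt (E : Type*) {M : Type*} [NormedAddCommGroup E] [NormedSpace ℝ E]
    [TopologicalSpace M] [ChartedSpace E M] (γ : ℝ → M) (t : ℝ) : Prop :=
  ContMDiffAt 𝓘(ℝ, ℝ) 𝓘(ℝ, E) ω γ t ∧ Function.Injective (mfderiv 𝓘(ℝ, ℝ) 𝓘(ℝ, E) γ t)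

theorem analyticAt_extChartAt_comp [IsManifold 𝓘(ℝ, E) ω M] [CompleteSpace E] {α : ℝ → M} {s : ℝ}
    (hα : ContMDiffAt 𝓘(ℝ, ℝ) 𝓘(ℝ, E) ω α s) {x : M} (hx : α s ∈ (chartAt E x).source) :
    AnalyticAt ℝ (extChartAt 𝓘(ℝ, E) x ∘ α) s := by
  have h : ContMDiffAt 𝓘(ℝ, ℝ) 𝓘(ℝ, E) ω (extChartAt 𝓘(ℝ, E) x ∘ α) s :=
    (contMDiffAt_extChartAt' hx).comp s hα
  exact (contMDiffAt_iff_contDiffAt.1 h).analyticAt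

theorem IsImmersedAt.deriv_ne_zero {β : ℝ → M} {t : ℝ} (hβ : IsImmersedAt E β t) :
    deriv (extChartAt 𝓘(ℝ, E) (β t) ∘ β) t ≠ 0 := by
  have hd : MDifferentiableAt 𝓘(ℝ, ℝ) 𝓘(ℝ, E) β t := hβ.1.mdifferentiableAt (by simp)
  have h := hβ.2
  rw [hd.mfderiv] at h
  simp only [writtenInExtChartAt, extChartAt_model_space_eq_id, PartialEquiv.refl_symm,
    PartialEquiv.refl_coe, Function.comp_id, modelWithCornersSelf_coe, range_id,
    fderivWithin_univ, id_eq] at h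
  intro h0
  have h1 : (fderiv ℝ (extChartAt 𝓘(ℝ, E) (β t) ∘ β) t) (1 : ℝ) = 0 := h0
  have h2 : (1 : ℝ) = 0 := h (h1.trans (map_zero _).symm)
  exact one_ne_zero h2

theorem eventually_eq_of_extChartAt_comp {α β : ℝ → M} {s : ℝ} (hα : ContinuousAt α s)
    (hβ : ContinuousAt β s) {x : M} (hxα : α s ∈ (chartAt E x).source)
    (hxβ : β s ∈ (chartAt E x).source)
    (h : ∀ᶠ u in 𝓝 s, (extChartAt 𝓘(ℝ, E) x ∘ α) u = (extChartAt 𝓘(ℝ, E) x ∘ β) u) :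
    ∀ᶠ u in 𝓝 s, α u = β u := by
  have hα' := hα.eventually_mem ((chartAt E x).open_source.mem_nhds hxα)
  have hβ' := hβ.eventually_mem ((chartAt E x).open_source.mem_nhds hxβ)
  filter_upwards [h, hα', hβ'] with u hu h1 h2
  refine (extChartAt 𝓘(ℝ, E) x).injOn ?_ ?_ hu
  · simpa using h1
  · simpa using h2

/-- Identity theorem at a point. -/
theorem eventually_eq_of_frequently_eq [IsManifold 𝓘(ℝ, E) ω M] [CompleteSpace E] [T2Space M]
    {α β : ℝ → M} {s : ℝ} (hα : ContMDiffAt 𝓘(ℝ, ℝ) 𝓘(ℝ, E) ω α s)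
    (hβ : ContMDiffAt 𝓘(ℝ, ℝ) 𝓘(ℝ, E) ω β s) (h : ∃ᶠ u in 𝓝[≠] s, α u = β u) :
    ∀ᶠ u in 𝓝 s, α u = β u := by
  have hs : α s = β s := by
    by_contra hne
    have hmem : {q : M × M | q.1 ≠ q.2} ∈ 𝓝 (α s, β s) :=
      isClosed_diagonal.isOpen_compl.mem_nhds hne
    have := (hα.continuousAt.prodMk hβ.continuousAt).eventually_mem hmem
    exact h ((this.filter_mono nhdsWithin_le_nhds).mono fun u hu => hu)
  have hxα : α s ∈ (chartAt E (β s)).source := by rw [hs]; exact mem_chart_source E _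
  refine eventually_eq_of_extChartAt_comp hα.continuousAt hβ.continuousAt hxα
    (mem_chart_source E _) ?_
  refine ((analyticAt_extChartAt_comp hα hxα).frequently_eq_iff_eventually_eq
    (analyticAt_extChartAt_comp hβ (mem_chart_source E _))).1 (h.mono fun u hu => ?_)
  simp [hu]

/-- Identity theorem on an interval. -/
theorem eqOn_of_frequently_eq [IsManifold 𝓘(ℝ, E) ω M] [CompleteSpace E] [T2Space M]
    {α β : ℝ → M} {I : Set ℝ} (hI : IsPreconnected I)
    (hα : ∀ s ∈ I, ContMDiffAt 𝓘(ℝ, ℝ) 𝓘(ℝ, E) ω α s)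
    (hβ : ∀ s ∈ I, ContMDiffAt 𝓘(ℝ, ℝ) 𝓘(ℝ, E) ω β s) {s : ℝ} (hs : s ∈ I)
    (h : ∃ᶠ u in 𝓝[≠] s, α u = β u) : EqOn α β I := by
  have hsub : I ⊆ {t | ∀ᶠ u in 𝓝 t, α u = β u} := by
    refine hI.subset_of_closure_inter_subset (isOpen_setOfPred_eventually_nhds)
      ⟨s, hs, eventually_eq_of_frequently_eq (hα s hs) (hβ s hs) h⟩ ?_
    rintro t ⟨htc, htI⟩
    refine eventually_eq_of_frequently_eq (hα t htI) (hβ t htI) ?_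
    by_contra hcon
    rw [not_frequently, eventually_nhdsWithin_iff] at hcon
    obtain ⟨U, hU, hUo, htU⟩ := eventually_nhds_iff.1 hcon
    obtain ⟨v, hvU, hv⟩ := mem_closure_iff_nhds.1 htc U (hUo.mem_nhds htU)
    have h1 : ∀ᶠ u in 𝓝 v, α u = β u ∧ u ∈ U := hv.and (hUo.mem_nhds hvU)
    -- The point `v` may be `t` itself, so a nearby coincidence to the right of `v` and different
    -- from `t` is used instead.
    obtain ⟨w, ⟨hw, hwU⟩, hwt⟩ := ((h1.filter_mono nhdsWithin_le_nhds).and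
      (show ∀ᶠ u in 𝓝[>] v, u ≠ t by
        rcases lt_or_ge v t with hvt | hvt
        · filter_upwards [Ioo_mem_nhdsGT hvt] with u hu using hu.2.ne
        · filter_upwards [self_mem_nhdsWithin] with u hu using (hvt.trans_lt hu).ne')).exists
    exact hU w hwU hwt hw
  exact fun t ht => (hsub ht).self_of_nhds

/-- A curve that is immersed at `t` has an analytic local retraction (in a chart of `M`). -/
theorem IsImmersedAt.exists_retraction [IsManifold 𝓘(ℝ, E) ω M] [CompleteSpace E]
    {β : ℝ → M} {t : ℝ} (hβ : IsImmersedAt E β t) :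
    ∃ π : E → ℝ, AnalyticAt ℝ π (extChartAt 𝓘(ℝ, E) (β t) (β t)) ∧
      ∀ᶠ u in 𝓝 t, π (extChartAt 𝓘(ℝ, E) (β t) (β u)) = u := by
  set φ := extChartAt 𝓘(ℝ, E) (β t) with hφ
  have ha : AnalyticAt ℝ (φ ∘ β) t := analyticAt_extChartAt_comp hβ.1 (mem_chart_source E _)
  -- A functional that does not kill the velocity turns the curve into a local diffeomorphism of ℝ;
  -- its local inverse, applied after `ℓ`, is the retraction.
  obtain ⟨ℓ, hℓ⟩ := SeparatingDual.exists_ne_zero (R := ℝ) hβ.deriv_ne_zero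
  have hla : AnalyticAt ℝ (fun u => ℓ (φ (β u))) t := (ℓ.analyticAt _).comp ha
  have hld : deriv (fun u => ℓ (φ (β u))) t ≠ 0 := by
    have := (ℓ.hasFDerivAt.comp_hasDerivAt t ha.differentiableAt.hasDerivAt).deriv
    intro h0
    exact hℓ (this.symm.trans h0)
  refine ⟨fun e => hla.hasStrictDerivAt.localInverse _ _ _ hld (ℓ e), ?_, ?_⟩
  · exact AnalyticAt.comp (hla.analyticAt_localInverse hld) (ℓ.analyticAt _)
  · exact hla.hasStrictDerivAt.eventually_left_inverse hld

theorem IsImmersedAt.eventually_injOn [IsManifold 𝓘(ℝ, E) ω M] [CompleteSpace E]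
    {β : ℝ → M} {t : ℝ} (hβ : IsImmersedAt E β t) : ∃ U ∈ 𝓝 t, InjOn β U := by
  obtain ⟨π, -, hπ⟩ := hβ.exists_retraction
  refine ⟨_, hπ, fun u hu v hv huv => ?_⟩
  have hu' : π (extChartAt 𝓘(ℝ, E) (β t) (β u)) = u := hu
  have hv' : π (extChartAt 𝓘(ℝ, E) (β t) (β v)) = v := hv
  rw [← hu', ← hv', huv]

/-- An analytic curve that meets an immersive curve infinitely often near a point runs inside it. -/
theorem exists_analyticAt_reparam [IsManifold 𝓘(ℝ, E) ω M] [CompleteSpace E]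
    {α β : ℝ → M} {s t : ℝ} (hα : ContMDiffAt 𝓘(ℝ, ℝ) 𝓘(ℝ, E) ω α s) (hβ : IsImmersedAt E β t)
    (hst : α s = β t) (h : ∀ T ∈ 𝓝 t, ∃ᶠ u in 𝓝[≠] s, α u ∈ β '' T) :
    ∃ ρ : ℝ → ℝ, AnalyticAt ℝ ρ s ∧ ρ s = t ∧ ∀ᶠ u in 𝓝 s, α u = β (ρ u) := by
  obtain ⟨π, hπa, hπ⟩ := hβ.exists_retraction
  set φ := extChartAt 𝓘(ℝ, E) (β t) with hφ
  have hxα : α s ∈ (chartAt E (β t)).source := by rw [hst]; exact mem_chart_source E _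
  have haα : AnalyticAt ℝ (φ ∘ α) s := analyticAt_extChartAt_comp hα hxα
  have haβ : AnalyticAt ℝ (φ ∘ β) t := analyticAt_extChartAt_comp hβ.1 (mem_chart_source E _)
  have hρs : π (φ (α s)) = t := by rw [hst]; exact hπ.self_of_nhds
  have hρa : AnalyticAt ℝ (fun u => π (φ (α u))) s := by
    refine AnalyticAt.comp (f := φ ∘ α) ?_ haα
    simpa [hst] using hπa
  have hcomp : AnalyticAt ℝ (φ ∘ (β ∘ fun u => π (φ (α u)))) s := by
    refine AnalyticAt.comp (g := φ ∘ β) (f := fun u => π (φ (α u))) ?_ hρa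
    rw [hρs]; exact haβ
  -- Retracting `α` is the only possible choice of `ρ`. The identity `α = β ∘ ρ` is automatic
  -- wherever `α` hits `β` near `t`, and these parameters accumulate at `s`.
  refine ⟨fun u => π (φ (α u)), hρa, hρs, ?_⟩
  have hβc : ContinuousAt (β ∘ fun u => π (φ (α u))) s := by
    refine ContinuousAt.comp (g := β) (f := fun u => π (φ (α u))) ?_ hρa.continuousAt
    rw [hρs]; exact hβ.1.continuousAt
  refine eventually_eq_of_extChartAt_comp (β := β ∘ fun u => π (φ (α u))) hα.continuousAt hβc hxα
    ?_ ?_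
  · simp only [Function.comp_apply, hρs]; exact mem_chart_source E _
  · refine (haα.frequently_eq_iff_eventually_eq hcomp).1 ((h _ hπ).mono ?_)
    rintro u ⟨t', ht', hu⟩
    have ht'' : π (φ (β t')) = t' := ht'
    simp only [Function.comp_apply]
    rw [← hu, ht'']

end Curves

/-! ### The transition maps of a curve -/

section Transition

variable {G M : Type*} [Group G] [MulAction G M]

/-- The parameters in `[-a, a]` that `g` moves into the curve `γ|[-a, a]`. -/
def transDom (γ : ℝ → M) (a : ℝ) (g : G) : Set ℝ :=
  {s ∈ Icc (-a) a | g • γ s ∈ γ '' Icc (-a) a}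

/-- The map `γ⁻¹ ∘ g ∘ γ` on `transDom γ a g`. -/
noncomputable def transMap (γ : ℝ → M) (a : ℝ) (g : G) (s : ℝ) : ℝ :=
  Function.invFunOn γ (Icc (-a) a) (g • γ s)

section

variable {γ : ℝ → M} {a : ℝ} {g : G} {s t : ℝ}

theorem transMap_mem (hs : s ∈ transDom γ a g) : transMap γ a g s ∈ Icc (-a) a :=
  Function.invFunOn_mem hs.2

theorem apply_transMap (hs : s ∈ transDom γ a g) : γ (transMap γ a g s) = g • γ s :=
  Function.invFunOn_eq hs.2

theorem mem_transDom (hs : s ∈ Icc (-a) a) (ht : t ∈ Icc (-a) a) (h : g • γ s = γ t) :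
    s ∈ transDom γ a g :=
  ⟨hs, t, ht, h.symm⟩

theorem transMap_mem_transDom_inv (hs : s ∈ transDom γ a g) : transMap γ a g s ∈ transDom γ a g⁻¹ :=
  mem_transDom (transMap_mem hs) hs.1 (by rw [apply_transMap hs, inv_smul_smul])

end

variable [TopologicalSpace M]

/-- The topological properties of a short analytic immersive curve that are used below. -/
structure IsTransCurve (G : Type*) {M : Type*} [Group G] [MulAction G M] [TopologicalSpace M]
    (γ : ℝ → M) (a : ℝ) : Prop where
  pos : 0 < a
  continuousOn : ContinuousOn γ (Icc (-a) a)
  injOn : InjOn γ (Icc (-a) a)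
  continuous_smul : ∀ g : G, Continuous fun x : M => g • x
  sated : ∀ t ∈ Icc (-a) a, IsSated G (γ t)

/-- A curve with satedness, whose transition domains are open away from their ends. -/
structure IsOpenTransCurve (G : Type*) {M : Type*} [Group G] [MulAction G M] [TopologicalSpace M]
    (γ : ℝ → M) (a : ℝ) : Prop extends IsTransCurve G γ a where
  dom_mem_nhds : ∀ (g : G), ∀ s ∈ Ioo (-a) a, AccPt s (𝓟 (transDom γ a g)) →
    transMap γ a g s ∈ Ioo (-a) a → transDom γ a g ∈ 𝓝 s

/-- Inside `(-r, r)`, the curve `γ` and its translate by `g` meet infinitely often. -/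
def Meets (γ : ℝ → M) (a r : ℝ) (g : G) : Prop :=
  ∃ s, AccPt s (𝓟 (transDom γ a g)) ∧ |s| < r ∧ |transMap γ a g s| < r

/-- Turns the sequential definition into a neighbourhood statement: failure on each member of a
countable basis at `x` would produce the forbidden sequence. -/
theorem IsSated.exists_nhds [FirstCountableTopology M] {x y z : M} (hx : IsSated G x)
    (hy : y ≠ x) (hz : z ≠ x) (hyz : y ≠ z) :
    ∃ N ∈ 𝓝 x, ∀ g : G, ¬ (g • y ∈ N ∧ g • z ∈ N) := by
  by_contra! hcon
  obtain ⟨N, hN⟩ := (𝓝 x).exists_antitone_basis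
  choose g hg using fun n => hcon (N n) (hN.mem n)
  exact hx ⟨y, z, hy, hz, hyz, g, hN.tendsto fun n => (hg n).1, hN.tendsto fun n => (hg n).2⟩

namespace IsTransCurve

variable {γ : ℝ → M} {a : ℝ} {g : G} {s t : ℝ}

theorem map_eq (hγ : IsTransCurve G γ a) (hs : s ∈ Icc (-a) a) (ht : t ∈ Icc (-a) a)
    (h : g • γ s = γ t) : transMap γ a g s = t :=
  hγ.injOn (transMap_mem (mem_transDom hs ht h)) ht ((apply_transMap (mem_transDom hs ht h)).trans h)

theorem map_injOn (hγ : IsTransCurve G γ a) (g : G) :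
    InjOn (transMap γ a g) (transDom γ a g) := by
  intro s hs t ht hst
  have h := congrArg γ hst
  rw [apply_transMap hs, apply_transMap ht, smul_left_cancel_iff] at h
  exact hγ.injOn hs.1 ht.1 h

theorem map_inv_map (hγ : IsTransCurve G γ a) (hs : s ∈ transDom γ a g) :
    transMap γ a g⁻¹ (transMap γ a g s) = s :=
  hγ.map_eq (transMap_mem hs) hs.1 (by rw [apply_transMap hs, inv_smul_smul])

theorem isClosed_setOf_smul_mem (hγ : IsTransCurve G γ a) [T2Space M] (g : G) {C : Set ℝ}
    (hC : IsClosed C) : IsClosed {s ∈ Icc (-a) a | g • γ s ∈ γ '' (Icc (-a) a ∩ C)} := by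
  have hcpt : IsCompact (γ '' (Icc (-a) a ∩ C)) :=
    (isCompact_Icc.inter_right hC).image_of_continuousOn
      (hγ.continuousOn.mono inter_subset_left)
  exact ((hγ.continuous_smul g).comp_continuousOn hγ.continuousOn).preimage_isClosed_of_isClosed
    isClosed_Icc hcpt.isClosed

theorem isClosed_dom (hγ : IsTransCurve G γ a) [T2Space M] (g : G) :
    IsClosed (transDom γ a g) := by
  simpa [transDom] using hγ.isClosed_setOf_smul_mem g isClosed_univ

/-- Injectivity of `γ` identifies the preimage of a closed set `C` with the parameters moved into
the compact set `γ '' (Icc (-a) a ∩ C)`, and these form a closed set. -/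
theorem continuousOn_map (hγ : IsTransCurve G γ a) [T2Space M] (g : G) :
    ContinuousOn (transMap γ a g) (transDom γ a g) := by
  rw [continuousOn_iff_isClosed]
  intro C hC
  refine ⟨_, hγ.isClosed_setOf_smul_mem g hC, ?_⟩
  ext s
  constructor
  · rintro ⟨hsC, hs⟩
    exact ⟨⟨hs.1, _, ⟨transMap_mem hs, hsC⟩, apply_transMap hs⟩, hs⟩
  · rintro ⟨⟨hs, t, ⟨ht, htC⟩, hst⟩, hs'⟩
    refine ⟨?_, hs'⟩
    rw [mem_preimage, hγ.map_eq hs ht hst.symm]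
    exact htC

theorem mem_dom_of_accPt (hγ : IsTransCurve G γ a) [T2Space M]
    (hs : AccPt s (𝓟 (transDom γ a g))) : s ∈ transDom γ a g :=
  isClosed_iff_clusterPt.1 (hγ.isClosed_dom g) s hs.clusterPt

variable [FirstCountableTopology M]

/-- Satedness, uniformly along a compact part of the curve. -/
theorem exists_uniform (hγ : IsTransCurve G γ a) {P : Set ℝ} (hP : IsCompact P)
    (hPa : P ⊆ Icc (-a) a) {w w' : ℝ} (hw : w ∈ Icc (-a) a) (hw' : w' ∈ Icc (-a) a)
    (hwP : w ∉ P) (hwP' : w' ∉ P) (hww : w ≠ w') :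
    ∃ δ > 0, ∀ p ∈ P, ∀ x ∈ Icc (-a) a, ∀ x' ∈ Icc (-a) a, |x - p| ≤ δ → |x' - p| ≤ δ →
      ∀ g : G, ¬ (g • γ w = γ x ∧ g • γ w' = γ x') := by
  by_contra! hcon
  obtain ⟨d, -, hdpos, hd⟩ := exists_seq_strictAnti_tendsto (0 : ℝ)
  choose p hp x hx x' hx' hxp hxp' g hg using fun n => hcon (d n) (hdpos n)
  obtain ⟨q, hq, φ, hφ, hpq⟩ := hP.tendsto_subseq hp
  have hdφ : Tendsto (d ∘ φ) atTop (𝓝 0) := hd.comp hφ.tendsto_atTop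
  -- Both families of nearby parameters inherit the limit `q`, at which satedness is then applied to
  -- the fixed pair `γ w`, `γ w'`.
  have key : ∀ y : ℕ → ℝ, (∀ n, |y n - p n| ≤ d n) → Tendsto (y ∘ φ) atTop (𝓝 q) := by
    intro y hy
    have h0 : Tendsto (fun n => y (φ n) - p (φ n)) atTop (𝓝 0) :=
      squeeze_zero_norm (fun n => hy (φ n)) hdφ
    refine (h0.add hpq).congr' (Eventually.of_forall fun n => ?_) |>.trans (by rw [zero_add])
    simp
  have hqa := hPa hq
  obtain ⟨N, hN, hgN⟩ := (hγ.sated q hqa).exists_nhds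
    (fun h => hwP (hγ.injOn hw hqa h ▸ hq)) (fun h => hwP' (hγ.injOn hw' hqa h ▸ hq))
    (fun h => hww (hγ.injOn hw hw' h))
  have hlim : ∀ y : ℕ → ℝ, (∀ n, |y n - p n| ≤ d n) → (∀ n, y n ∈ Icc (-a) a) →
      ∀ᶠ n in atTop, γ (y (φ n)) ∈ N := fun y hy hya =>
    ((hγ.continuousOn q hqa).tendsto.comp (tendsto_nhdsWithin_iff.2
      ⟨key y hy, Eventually.of_forall fun n => hya (φ n)⟩)).eventually hN
  obtain ⟨n, h1, h2⟩ := ((hlim x hxp hx).and (hlim x' hxp' hx')).exists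
  refine hgN (g (φ n)) ⟨?_, ?_⟩
  · rw [(hg (φ n)).1]; exact h1
  · rw [(hg (φ n)).2]; exact h2

variable [T2Space M]

/-- If `γ` and `g • γ` meet near the centre, then the transition map of `g` is defined on a uniform
neighbourhood of the centre, and has small values there. -/
theorem _root_.AnalyticCurves.IsOpenTransCurve.exists_radius (hγ : IsOpenTransCurve G γ a) {ε : ℝ} (hε : 0 < ε) (hεa : ε ≤ a) :
    ∃ η > 0, η ≤ ε ∧ ∀ g : G, Meets γ a η g →
      Ioo (-η) η ⊆ transDom γ a g ∧ ∀ x ∈ Ioo (-η) η, |transMap γ a g x| < ε := by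
  have h0 : ({0} : Set ℝ) ⊆ Icc (-a) a := by
    rw [singleton_subset_iff]; constructor <;> linarith [hγ.pos]
  -- An interval of values that starts below `ε / 2` and reaches `ε` contains both numbers; then
  -- `g⁻¹` moves two fixed points close to `γ 0`, which satedness forbids. The negative pair serves
  -- the other side.
  obtain ⟨δ₁, hδ₁, h₁⟩ := hγ.exists_uniform isCompact_singleton h0 (w := ε / 2) (w' := ε)
    ⟨by linarith, by linarith⟩ ⟨by linarith, by linarith⟩ (by simp [hε.ne']) (by simp [hε.ne'])
    (by linarith)
  obtain ⟨δ₂, hδ₂, h₂⟩ := hγ.exists_uniform isCompact_singleton h0 (w := -(ε / 2)) (w' := -ε)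
    ⟨by linarith, by linarith⟩ ⟨by linarith, by linarith⟩ (by simp [hε.ne']) (by simp [hε.ne'])
    (by linarith)
  obtain ⟨η, hη0, hηlt⟩ := exists_between (lt_min (lt_min hδ₁ hδ₂) (half_pos hε))
  obtain ⟨⟨hη1, hη2⟩, hη3⟩ : (η < δ₁ ∧ η < δ₂) ∧ η < ε / 2 := by simpa using hηlt
  refine ⟨η, hη0, by linarith, fun g ⟨s, hs, hsη, hfs⟩ => ?_⟩
  set D := transDom γ a g with hD
  set f := transMap γ a g with hf
  -- A preconnected set of parameters cannot be spread by `f` up to `± ε`.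
  have small : ∀ C ⊆ D, C ⊆ Ioo (-η) η → IsPreconnected C → s ∈ C → ∀ x ∈ C, |f x| < ε := by
    intro C hCD hCη hC hsC x hx
    by_contra! hcon
    have hord := (hC.image f ((hγ.continuousOn_map g).mono hCD)).ordConnected
    have hfsC := mem_image_of_mem f hsC
    have hfxC := mem_image_of_mem f hx
    have hsm := abs_lt.1 hfs
    have hit : ∀ c ∈ f '' C, ∃ p ∈ Icc (-a) a, |p - 0| ≤ η ∧ g⁻¹ • γ c = γ p := by
      rintro _ ⟨p, hp, rfl⟩
      refine ⟨p, (hCD hp).1, ?_, ?_⟩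
      · rw [sub_zero]; exact (abs_lt.2 (hCη hp)).le
      · rw [apply_transMap (hCD hp), inv_smul_smul]
    rcases le_abs.1 hcon with h | h
    · obtain ⟨p, hpa, hp, hp'⟩ := hit (ε / 2) (hord.out hfsC hfxC ⟨by linarith, by linarith⟩)
      obtain ⟨q, hqa, hq, hq'⟩ := hit (ε) (hord.out hfsC hfxC ⟨by linarith, by linarith⟩)
      exact h₁ 0 rfl p hpa q hqa (by linarith) (by linarith) g⁻¹ ⟨hp', hq'⟩
    · obtain ⟨p, hpa, hp, hp'⟩ :=
        hit (-(ε / 2)) (hord.out hfxC hfsC ⟨by linarith, by linarith⟩)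
      obtain ⟨q, hqa, hq, hq'⟩ := hit (-ε) (hord.out hfxC hfsC ⟨by linarith, by linarith⟩)
      exact h₂ 0 rfl p hpa q hqa (by linarith) (by linarith) g⁻¹ ⟨hp', hq'⟩
  have toIoo : ∀ x, |f x| < ε → f x ∈ Ioo (-a) a := fun x hx =>
    ⟨by linarith [(abs_lt.1 hx).1], by linarith [(abs_lt.1 hx).2]⟩
  have hηa : ∀ x ∈ Ioo (-η) η, x ∈ Ioo (-a) a := fun x hx =>
    ⟨by linarith [hx.1], by linarith [hx.2]⟩
  have hsI : s ∈ Ioo (-η) η := abs_lt.1 hsη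
  have hsD : D ∈ 𝓝 s := hγ.dom_mem_nhds g s (hηa s hsI) hs (toIoo s (by linarith))
  set O := interior D ∩ Ioo (-η) η with hO
  have hOo : IsOpen O := isOpen_interior.inter isOpen_Ioo
  have hsO : s ∈ O := ⟨mem_interior_iff_mem_nhds.2 hsD, hsI⟩
  set C := connectedComponentIn O s with hCdef
  have hCO : C ⊆ O := connectedComponentIn_subset _ _
  have hsC : s ∈ C := mem_connectedComponentIn hsO
  have hCo : IsOpen C := hOo.connectedComponentIn
  -- The component `C` is relatively closed in `(-η, η)`: at a limit point the values are still
  -- small by `small`, hence interior, so the openness of the domain lets `C` continue past that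
  -- point.
  have hIC : Ioo (-η) η ⊆ C := by
    refine isPreconnected_Ioo.subset_of_closure_inter_subset hCo ⟨s, hsI, hsC⟩ ?_
    rintro x ⟨hxC, hxI⟩
    have hpre : IsPreconnected (insert x C) :=
      isPreconnected_connectedComponentIn.subset_closure (subset_insert _ _)
        (insert_subset hxC subset_closure)
    have hCD : C ⊆ D := fun y hy => interior_subset (hCO hy).1
    have hxD : x ∈ D := closure_minimal hCD (hγ.isClosed_dom g) hxC
    have hacc : AccPt x (𝓟 D) := by
      by_cases hxs : x = s
      · rwa [hxs]
      · exact (hpre.preperfect_of_nontrivial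
          ⟨x, mem_insert _ _, s, mem_insert_of_mem _ hsC, hxs⟩ x (mem_insert _ _)).mono
          (principal_mono.2 (insert_subset hxD hCD))
    have hfx : |f x| < ε := small (insert x C) (insert_subset hxD hCD)
      (insert_subset hxI fun y hy => (hCO hy).2) hpre (mem_insert_of_mem _ hsC) x (mem_insert _ _)
    have hxO : x ∈ O := ⟨mem_interior_iff_mem_nhds.2
      (hγ.dom_mem_nhds g x (hηa x hxI) hacc (toIoo x hfx)), hxI⟩
    exact hpre.subset_connectedComponentIn (mem_insert_of_mem _ hsC)
      (insert_subset hxO hCO) (mem_insert _ _)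
  have hID : Ioo (-η) η ⊆ D := fun x hx => interior_subset (hCO (hIC hx)).1
  exact ⟨hID, fun x hx => small _ hID Subset.rfl isPreconnected_Ioo hsI x hx⟩

end IsTransCurve

end Transition

/-! ### Monotone transition maps -/

section Monotone

variable {G M : Type*} [Group G] [MulAction G M]

/-- Three points to the right of an almost fixed point `p` of a monotone transition map can be
pulled back by iteration until two of them are close to `p`. -/
theorem exists_iterate_pullback {γ : ℝ → M} {g : G} {φ : ℝ → ℝ} {p v δ : ℝ}
    (hmono : StrictMonoOn φ (Icc p v)) (hcont : ContinuousOn φ (Icc p v))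
    (hp : φ p = p + δ) (hpush : ∀ x ∈ Icc p v, x + δ ≤ φ x)
    (hg : ∀ x ∈ Icc p v, g • γ x = γ (φ x)) (N : ℕ) :
    ∀ x₁ x₂ x₃ y : ℝ, x₁ < x₂ → x₂ < x₃ → p ≤ x₁ → x₁ ≤ p + N * δ → y ∈ Icc p v → y ≤ x₁ →
      x₃ ≤ φ y → ∃ k : ℕ, ∃ u ∈ Icc p (p + δ), ∃ u' ∈ Icc p (p + δ),
        (g ^ k • γ u = γ x₁ ∧ g ^ k • γ u' = γ x₂) ∨
        (g ^ k • γ u = γ x₂ ∧ g ^ k • γ u' = γ x₃) := by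
  induction N with
  | zero =>
    intro x₁ x₂ x₃ y h12 h23 hpx hxN hy hyx hx3
    have hx1 : x₁ = p := le_antisymm (by simpa using hxN) hpx
    have hyp : y = p := le_antisymm (hx1 ▸ hyx) hy.1
    subst hyp
    exact ⟨0, x₁, ⟨hpx, by linarith⟩, x₂, ⟨by linarith, by linarith⟩, Or.inl (by simp)⟩
  | succ N ih =>
    intro x₁ x₂ x₃ y h12 h23 hpx hxN hy hyx hx3
    have hsub : Icc p y ⊆ Icc p v := Icc_subset_Icc_right hy.2
    have pre : ∀ x, φ p ≤ x → x ≤ φ y → ∃ u ∈ Icc p y, φ u = x := fun x h1 h2 =>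
      intermediate_value_Icc hy.1 (hcont.mono hsub) ⟨h1, h2⟩
    -- If `x₁` is below `φ p = p + δ`, the process stops. Either `x₂` is there too, or `x₂` and `x₃`
    -- are pulled back once more and land in `[p, y]`, with `y ≤ x₁ < p + δ`.
    rcases lt_or_ge x₁ (φ p) with hlt | hge
    · rcases le_or_gt x₂ (φ p) with hle | hgt
      · exact ⟨0, x₁, ⟨hpx, by linarith⟩, x₂, ⟨by linarith, by linarith⟩, Or.inl (by simp)⟩
      · obtain ⟨u, hu, hux⟩ := pre x₂ hgt.le (by linarith)
        obtain ⟨u', hu', hux'⟩ := pre x₃ (by linarith) hx3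
        refine ⟨1, u, ⟨hu.1, by linarith [hu.2]⟩, u', ⟨hu'.1, by linarith [hu'.2]⟩, Or.inr ?_⟩
        rw [pow_one, hg u (hsub hu), hg u' (hsub hu'), hux, hux']
        exact ⟨rfl, rfl⟩
    · obtain ⟨y₁, hy1, hyx1⟩ := pre x₁ hge (by linarith)
      obtain ⟨y₂, hy2, hyx2⟩ := pre x₂ (by linarith) (by linarith)
      obtain ⟨y₃, hy3, hyx3⟩ := pre x₃ (by linarith) hx3
      have h12' : y₁ < y₂ := (hmono.lt_iff_lt (hsub hy1) (hsub hy2)).1 (by linarith)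
      have h23' : y₂ < y₃ := (hmono.lt_iff_lt (hsub hy2) (hsub hy3)).1 (by linarith)
      have hstep := hpush y₁ (hsub hy1)
      push_cast at hxN
      -- The preimage `y₁` also takes over the role of `y`, since `y₃ ≤ y ≤ x₁ = φ y₁`. As `φ`
      -- pushes by at least `δ`, the step uses up one unit of `N`.
      obtain ⟨k, u, hu, u', hu', h⟩ := ih y₁ y₂ y₃ y₁ h12' h23' hy1.1 (by linarith) (hsub hy1)
        le_rfl (by rw [hyx1]; linarith [hy3.2])
      refine ⟨k + 1, u, hu, u', hu', ?_⟩
      rw [← hyx1, ← hyx2, ← hyx3, ← hg y₁ (hsub hy1), ← hg y₂ (hsub hy2), ← hg y₃ (hsub hy3),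
        pow_succ']
      simpa only [mul_smul, smul_left_cancel_iff] using h

namespace IsTransCurve

variable [TopologicalSpace M] {γ : ℝ → M} {a : ℝ}

theorem comp_neg (hγ : IsTransCurve G γ a) : IsTransCurve G (fun t => γ (-t)) a where
  pos := hγ.pos
  continuousOn := hγ.continuousOn.comp continuousOn_neg fun t ht =>
    ⟨by linarith [ht.2], by linarith [ht.1]⟩
  injOn := hγ.injOn.comp neg_injective.injOn fun t ht =>
    ⟨by linarith [ht.2], by linarith [ht.1]⟩
  continuous_smul := hγ.continuous_smul
  sated t ht := hγ.sated (-t) ⟨by linarith [ht.2], by linarith [ht.1]⟩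

variable [FirstCountableTopology M]

/-- A monotone transition map with an almost fixed point cannot push a point to the right of it
by a fixed amount. -/
theorem exists_no_push (hγ : IsTransCurve G γ a) {c d : ℝ} (hc : -a ≤ c) (hcd : c < d)
    (hd : d ≤ a) : ∃ δ > 0, ∀ (g : G) (φ : ℝ → ℝ) (s v : ℝ), -a ≤ s → s ≤ v → v ≤ c →
      StrictMonoOn φ (Icc s v) → ContinuousOn φ (Icc s v) →
      (∀ x ∈ Icc s v, g • γ x = γ (φ x)) → φ s ≤ s + δ → φ v < d := by
  have hw : ∀ x, c < x → x < d → x ∈ Icc (-a) a ∧ x ∉ Icc (-a) c := fun x h1 h2 =>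
    ⟨⟨by linarith, by linarith⟩, fun h => by linarith [h.2]⟩
  -- Three test points are needed because only one of the pairs `(w₁, w₂)`, `(w₂, w₃)` is guaranteed
  -- to arrive simultaneously near the almost fixed point. Satedness is made uniform for both pairs.
  obtain ⟨w₁, hc1, h1d⟩ := exists_between hcd
  obtain ⟨w₂, h12, h2d⟩ := exists_between h1d
  obtain ⟨w₃, h23, h3d⟩ := exists_between h2d
  have hW₁ := hw w₁ hc1 h1d
  have hW₂ := hw w₂ (by linarith) h2d
  have hW₃ := hw w₃ (by linarith) h3d
  have hP : Icc (-a) c ⊆ Icc (-a) a := Icc_subset_Icc_right (by linarith)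
  obtain ⟨δ₁, hδ₁, h₁⟩ := hγ.exists_uniform isCompact_Icc hP hW₁.1 hW₂.1 hW₁.2 hW₂.2 h12.ne
  obtain ⟨δ₂, hδ₂, h₂⟩ := hγ.exists_uniform isCompact_Icc hP hW₂.1 hW₃.1 hW₂.2 hW₃.2 h23.ne
  -- The bound `δ < w₁ - c` makes the displacement at `v` exceed `δ` and keeps `p + δ` inside `[-a,
  -- a]`.
  obtain ⟨δ, hδ, hlt⟩ := exists_between (lt_min (lt_min hδ₁ hδ₂) (sub_pos.2 hc1))
  obtain ⟨⟨hd1, hd2⟩, hd3⟩ : (δ < δ₁ ∧ δ < δ₂) ∧ δ < w₁ - c := by simpa using hlt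
  refine ⟨δ, hδ, fun g φ s v hs hsv hvc hmono hcont hg hφs => ?_⟩
  by_contra! hdv
  have hcont' : ContinuousOn (fun x => φ x - x) (Icc s v) := hcont.sub continuousOn_id
  have hzero : ∀ x ∈ Icc s v, φ x - x ≤ δ → ∃ q ∈ Icc x v, φ q - q = δ := fun x hx hle =>
    intermediate_value_Icc hx.2 (hcont'.mono (Icc_subset_Icc_left hx.1)) ⟨hle, by linarith⟩
  have hcpt : IsCompact (Icc s v ∩ (fun x => φ x - x) ⁻¹' {δ}) :=
    isCompact_Icc.of_isClosed_subset
      (hcont'.preimage_isClosed_of_isClosed isClosed_Icc isClosed_singleton) inter_subset_left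
  obtain ⟨q, hq, hqδ⟩ := hzero s ⟨le_rfl, hsv⟩ (by linarith)
  -- Taking the last point with displacement exactly `δ` ensures a displacement of at least `δ`
  -- everywhere to its right.
  obtain ⟨p, ⟨hpI, hpδ⟩, hpmax⟩ := hcpt.exists_isGreatest ⟨q, hq, hqδ⟩
  have hpδ' : φ p - p = δ := hpδ
  have hpush : ∀ x ∈ Icc p v, x + δ ≤ φ x := by
    intro x hx
    by_contra! hxlt
    have hxI : x ∈ Icc s v := ⟨hpI.1.trans hx.1, hx.2⟩
    obtain ⟨r, hr, hrδ⟩ := hzero x hxI (by linarith)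
    have hrp : r ≤ p := hpmax ⟨⟨hxI.1.trans hr.1, hr.2⟩, hrδ⟩
    have : x = p := le_antisymm (hr.1.trans hrp) hx.1
    subst this
    linarith
  have hsub : Icc p v ⊆ Icc s v := Icc_subset_Icc_left hpI.1
  obtain ⟨N, hN⟩ := exists_nat_ge ((w₁ - p) / δ)
  rw [div_le_iff₀ hδ] at hN
  have hpv := hpI.2
  obtain ⟨k, u, hu, u', hu', h⟩ := exists_iterate_pullback (hmono.mono hsub) (hcont.mono hsub)
    (by linarith) hpush (fun x hx => hg x (hsub hx)) N w₁ w₂ w₃ v h12 h23 (by linarith)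
    (by linarith) ⟨hpI.2, le_rfl⟩ (by linarith) (by linarith)
  have hpP : p ∈ Icc (-a) c := ⟨hs.trans hpI.1, by linarith⟩
  have hclose : ∀ x ∈ Icc p (p + δ), x ∈ Icc (-a) a ∧ |x - p| ≤ δ := fun x hx =>
    ⟨⟨by linarith [hx.1, hpP.1], by linarith [hx.2]⟩, by
      rw [abs_of_nonneg (by linarith [hx.1])]; linarith [hx.2]⟩
  obtain ⟨hua, hup⟩ := hclose u hu
  obtain ⟨hua', hup'⟩ := hclose u' hu'
  rcases h with ⟨h1, h2⟩ | ⟨h1, h2⟩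
  · exact h₁ p hpP u hua u' hua' (by linarith) (by linarith) (g ^ k)⁻¹
      ⟨by rw [← h1, inv_smul_smul], by rw [← h2, inv_smul_smul]⟩
  · exact h₂ p hpP u hua u' hua' (by linarith) (by linarith) (g ^ k)⁻¹
      ⟨by rw [← h1, inv_smul_smul], by rw [← h2, inv_smul_smul]⟩

variable [T2Space M]

/-- An image of `u` at or above `u + ε` would be a push by `g` across `[u, u + ε]`. An image at or
below `u - ε` would be a push by `g⁻¹` across `[u - ε, u]`. Both are excluded by `exists_no_push`.
-/
theorem exists_abs_map_sub_lt_right (hγ : IsTransCurve G γ a) {u ε : ℝ} (hε : 0 < ε)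
    (hu : -a ≤ u - ε) (hu' : u + ε ≤ a) : ∃ δ > 0, ∀ (g : G) (s : ℝ), s ≤ u →
      Icc s u ⊆ transDom γ a g → StrictMonoOn (transMap γ a g) (Icc s u) →
      |transMap γ a g s - s| ≤ δ → |transMap γ a g u - u| < ε := by
  obtain ⟨δ₁, hδ₁, h₁⟩ := hγ.exists_no_push (c := u) (d := u + ε) (by linarith) (by linarith) hu'
  obtain ⟨δ₂, hδ₂, h₂⟩ := hγ.exists_no_push (c := u - ε) (d := u) hu (by linarith) (by linarith)
  refine ⟨min δ₁ δ₂, lt_min hδ₁ hδ₂, fun g s hsu hD hmono hδ => ?_⟩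
  set f := transMap γ a g
  have hcont : ContinuousOn f (Icc s u) := (hγ.continuousOn_map g).mono hD
  obtain ⟨hδ1, hδ2⟩ := abs_le.1 hδ
  have hm1 := min_le_left δ₁ δ₂
  have hm2 := min_le_right δ₁ δ₂
  have hsI : s ∈ Icc s u := ⟨le_rfl, hsu⟩
  have huI : u ∈ Icc s u := ⟨hsu, le_rfl⟩
  rw [abs_lt]
  constructor
  · by_contra! hcon
    have hpre : ∀ x ∈ Icc (f s) (f u), ∃ y ∈ Icc s u, f y = x := fun x hx =>
      intermediate_value_Icc hsu hcont hx
    refine lt_irrefl u ?_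
    have hlt := h₂ g⁻¹ (transMap γ a g⁻¹) (f s) (f u) (transMap_mem (hD hsI)).1
      (hmono.monotoneOn hsI huI hsu) (by linarith) ?_ ?_ ?_ ?_
    · rwa [hγ.map_inv_map (hD huI)] at hlt
    · intro x hx x' hx' hxx
      obtain ⟨y, hy, rfl⟩ := hpre x hx
      obtain ⟨y', hy', rfl⟩ := hpre x' hx'
      rw [hγ.map_inv_map (hD hy), hγ.map_inv_map (hD hy')]
      exact (hmono.lt_iff_lt hy hy').1 hxx
    · refine (hγ.continuousOn_map g⁻¹).mono fun x hx => ?_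
      obtain ⟨y, hy, rfl⟩ := hpre x hx
      exact transMap_mem_transDom_inv (hD hy)
    · intro x hx
      obtain ⟨y, hy, rfl⟩ := hpre x hx
      exact (apply_transMap (transMap_mem_transDom_inv (hD hy))).symm
    · rw [hγ.map_inv_map (hD hsI)]; linarith
  · have hlt := h₁ g f s u (hD hsI).1.1 hsu le_rfl hmono hcont
      (fun x hx => (apply_transMap (hD hx)).symm) (by linarith)
    linarith

/-- The mirror image of the previous statement, obtained by reversing the curve; conjugation by
negation keeps an increasing map increasing. -/
theorem exists_abs_map_sub_lt_left (hγ : IsTransCurve G γ a) {u ε : ℝ} (hε : 0 < ε)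
    (hu : -a ≤ u - ε) (hu' : u + ε ≤ a) : ∃ δ > 0, ∀ (g : G) (s : ℝ), u ≤ s →
      Icc u s ⊆ transDom γ a g → StrictMonoOn (transMap γ a g) (Icc u s) →
      |transMap γ a g s - s| ≤ δ → |transMap γ a g u - u| < ε := by
  obtain ⟨δ, hδ, h⟩ := hγ.comp_neg.exists_abs_map_sub_lt_right (u := -u) hε (by linarith)
    (by linarith)
  refine ⟨δ, hδ, fun g s hus hD hmono hs => ?_⟩
  have hneg : ∀ x ∈ Icc (-s) (-u), -x ∈ Icc u s := fun x hx =>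
    ⟨by linarith [hx.2], by linarith [hx.1]⟩
  have hmem : ∀ x ∈ Icc (-a) a, -x ∈ Icc (-a) a := fun x hx =>
    ⟨by linarith [hx.2], by linarith [hx.1]⟩
  have key : ∀ x ∈ Icc (-s) (-u), x ∈ transDom (fun t => γ (-t)) a g ∧
      transMap (fun t => γ (-t)) a g x = -transMap γ a g (-x) := by
    intro x hx
    have hxD := hD (hneg x hx)
    have hx' : x ∈ Icc (-a) a := by simpa using hmem _ hxD.1
    have heq : g • γ (-x) = γ (-(-transMap γ a g (-x))) := by rw [neg_neg, apply_transMap hxD]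
    exact ⟨mem_transDom hx' (hmem _ (transMap_mem hxD)) heq,
      hγ.comp_neg.map_eq hx' (hmem _ (transMap_mem hxD)) heq⟩
  have := h g (-s) (by linarith) (fun x hx => (key x hx).1) ?_ ?_
  · rw [(key (-u) ⟨by linarith, le_rfl⟩).2, neg_neg, ← abs_neg] at this
    convert this using 2
    ring
  · intro x hx y hy hxy
    rw [(key x hx).2, (key y hy).2, neg_lt_neg_iff]
    exact hmono (hneg y hy) (hneg x hx) (by linarith)
  · rw [(key (-s) ⟨le_rfl, by linarith⟩).2, neg_neg, ← abs_neg]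
    convert hs using 2
    ring

end IsTransCurve

end Monotone

/-! ### Sequences of increasing transition maps with almost fixed points -/

section Converging

variable {G M : Type*} [Group G] [MulAction G M] [TopologicalSpace M] [T2Space M]
  {γ : ℝ → M} {a : ℝ}

namespace IsTransCurve

/-- By compactness `γ` is a homeomorphism onto its image, so convergence in `M` can be read off in
the parameter. -/
theorem tendsto_of_tendsto_comp (hγ : IsTransCurve G γ a) {κ : Type*} {l : Filter κ}
    {x : κ → ℝ} {p : ℝ} (hx : ∀ᶠ n in l, x n ∈ Icc (-a) a) (hp : p ∈ Icc (-a) a)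
    (h : Tendsto (fun n => γ (x n)) l (𝓝 (γ p))) : Tendsto x l (𝓝 p) := by
  rw [tendsto_nhds]
  intro U hU hpU
  have hcl : IsClosed (γ '' (Icc (-a) a \ U)) :=
    ((isCompact_Icc.diff hU).image_of_continuousOn
      (hγ.continuousOn.mono sdiff_subset)).isClosed
  have hpn : γ p ∉ γ '' (Icc (-a) a \ U) := by
    rintro ⟨q, hq, hqp⟩
    exact hq.2 (hγ.injOn hq.1 hp hqp ▸ hpU)
  filter_upwards [hx, h.eventually_mem (hcl.isOpen_compl.mem_nhds hpn)] with n hn hn'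
  by_contra hnU
  exact hn' ⟨x n, ⟨hn, hnU⟩, rfl⟩

theorem strictMonoOn_or_strictAntiOn (hγ : IsTransCurve G γ a) {η : ℝ} (hη : 0 < η) {g : G}
    (hD : Ioo (-η) η ⊆ transDom γ a g) : StrictMonoOn (transMap γ a g) (Ioo (-η) η) ∨
      StrictAntiOn (transMap γ a g) (Ioo (-η) η) :=
  ContinuousOn.strictMonoOn_of_injOn_Ioo (by linarith) ((hγ.continuousOn_map g).mono hD)
    ((hγ.map_injOn g).mono hD)

/-- A transition map that is close to the identity moves infinitely many points of a
neighbourhood `V` into `V`. -/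
theorem infinite_inter (hγ : IsTransCurve G γ a) {S : Type*} {ι : S → M} {e : S → ℝ} {V : Set S}
    (hV : ∀ x ∈ V, γ (e x) = ι x) {p q m₁ m₂ : ℝ} (hpq : Icc p q ⊆ e '' V) {g : G}
    (hD : Icc p q ⊆ transDom γ a g) (hm : m₁ < m₂) (hpm : p ≤ m₁) (hmq : m₂ ≤ q)
    (hfp : transMap γ a g p ≤ m₁) (hfq : m₂ ≤ transMap γ a g q) :
    (g • (ι '' V) ∩ ι '' V).Infinite := by
  have hsub : Icc m₁ m₂ ⊆ Icc p q := Icc_subset_Icc hpm hmq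
  have hinf : (γ '' Icc m₁ m₂).Infinite :=
    (Icc_infinite hm).image (hγ.injOn.mono fun x hx => (hD (hsub hx)).1)
  refine hinf.mono ?_
  rintro _ ⟨m, hmI, rfl⟩
  obtain ⟨y, hy, hym⟩ := intermediate_value_Icc (hpm.trans (hm.le.trans hmq))
    ((hγ.continuousOn_map g).mono hD) ⟨hfp.trans hmI.1, hmI.2.trans hfq⟩
  obtain ⟨x, hxV, hxy⟩ := hpq hy
  obtain ⟨x', hxV', hxm⟩ := hpq (hsub hmI)
  constructor
  · refine ⟨ι x, mem_image_of_mem ι hxV, ?_⟩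
    rw [← hym, apply_transMap (hD hy), ← hxy, hV x hxV]
  · exact ⟨x', hxV', by rw [← hxm, hV x' hxV']⟩

variable [FirstCountableTopology M]

/-- Increasing transition maps with almost fixed points converge to the identity. -/
theorem tendsto_transMap (hγ : IsTransCurve G γ a) {η : ℝ} (hηa : η ≤ a)
    {g : ℕ → G} (hD : ∀ᶠ n in atTop, Ioo (-η) η ⊆ transDom γ a (g n))
    (hmono : ∀ᶠ n in atTop, StrictMonoOn (transMap γ a (g n)) (Ioo (-η) η))
    {s : ℕ → ℝ} {σ : ℝ} (hσ : σ ∈ Ioo (-η) η) (hs : Tendsto s atTop (𝓝 σ))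
    (hfs : Tendsto (fun n => transMap γ a (g n) (s n) - s n) atTop (𝓝 0))
    {u : ℝ} (hu : u ∈ Ioo (-η) η) :
    Tendsto (fun n => transMap γ a (g n) u) atTop (𝓝 u) := by
  have aux : ∀ (s : ℕ → ℝ) (u : ℝ), u ∈ Ioo (-η) η → (∀ᶠ n in atTop, s n ∈ Ioo (-η) η) →
      Tendsto (fun n => transMap γ a (g n) (s n) - s n) atTop (𝓝 0) →
      (∀ᶠ n in atTop, s n ≤ u) ∨ (∀ᶠ n in atTop, u ≤ s n) →
      Tendsto (fun n => transMap γ a (g n) u) atTop (𝓝 u) := by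
    intro s u hu hs hfs hor
    rw [Metric.tendsto_nhds]
    intro ε hε
    obtain ⟨ε', hε', hlt⟩ := exists_between
      (lt_min hε (lt_min (show 0 < u + a by linarith [hu.1]) (show 0 < a - u by linarith [hu.2])))
    obtain ⟨h1, h2, h3⟩ : ε' < ε ∧ ε' < u + a ∧ ε' < a - u := by simpa using hlt
    have hsmall : ∀ δ > 0, ∀ᶠ n in atTop, |transMap γ a (g n) (s n) - s n| ≤ δ := by
      intro δ hδ
      filter_upwards [(Metric.tendsto_nhds.1 hfs) δ hδ] with n hn
      rw [Real.dist_0_eq_abs] at hn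
      exact hn.le
    rcases hor with hle | hle
    · obtain ⟨δ, hδ, h⟩ := hγ.exists_abs_map_sub_lt_right hε' (by linarith : -a ≤ u - ε')
        (by linarith)
      filter_upwards [hle, hsmall δ hδ, hD, hmono, hs] with n hn hnδ hnD hnm hns
      have hsub : Icc (s n) u ⊆ Ioo (-η) η := fun x hx =>
        ⟨hns.1.trans_le hx.1, hx.2.trans_lt hu.2⟩
      exact (h (g n) (s n) hn (hsub.trans hnD) (hnm.mono hsub) hnδ).trans h1
    · obtain ⟨δ, hδ, h⟩ := hγ.exists_abs_map_sub_lt_left hε' (by linarith : -a ≤ u - ε')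
        (by linarith)
      filter_upwards [hle, hsmall δ hδ, hD, hmono, hs] with n hn hnδ hnD hnm hns
      have hsub : Icc u (s n) ⊆ Ioo (-η) η := fun x hx =>
        ⟨hu.1.trans_le hx.1, hx.2.trans_lt hns.2⟩
      exact (h (g n) (s n) hn (hsub.trans hnD) (hnm.mono hsub) hnδ).trans h1
  have hsI : ∀ᶠ n in atTop, s n ∈ Ioo (-η) η := hs.eventually_mem (isOpen_Ioo.mem_nhds hσ)
  have main : ∀ u ∈ Ioo (-η) η, u ≠ σ →
      Tendsto (fun n => transMap γ a (g n) u) atTop (𝓝 u) := by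
    intro u hu hne
    refine aux s u hu hsI hfs ?_
    rcases lt_or_gt_of_ne hne with h | h
    · exact Or.inr ((hs.eventually_mem (Ioi_mem_nhds h)).mono fun n hn => le_of_lt hn)
    · exact Or.inl ((hs.eventually_mem (Iio_mem_nhds h)).mono fun n hn => le_of_lt hn)
  -- At `σ` itself the sequence `s` may lie on both sides. A fixed `v < σ`, where convergence is
  -- already known, replaces it.
  by_cases hne : u = σ
  · subst hne
    obtain ⟨v, hv1, hv2⟩ := exists_between hu.1
    have hv : v ∈ Ioo (-η) η := ⟨hv1, hv2.trans hu.2⟩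
    refine aux (fun _ => v) u hu (Eventually.of_forall fun _ => hv) ?_
      (Or.inl (Eventually.of_forall fun _ => hv2.le))
    simpa using (main v hv hv2.ne).sub_const v
  · exact main u hu hne

end IsTransCurve

end Converging

/-! ### Analyticity of transition maps and openness of their domains -/

section Analytic

variable {F E G M : Type*} [NormedAddCommGroup F] [NormedSpace ℝ F]
  [NormedAddCommGroup E] [NormedSpace ℝ E]
  [TopologicalSpace G] [ChartedSpace F G] [Group G]
  [TopologicalSpace M] [ChartedSpace E M] [MulAction G M]

theorem IsAnalyticAction.contMDiffAt_smul (hact : IsAnalyticAction F E G M) (g : G) {γ : ℝ → M}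
    {t : ℝ} (h : ContMDiffAt 𝓘(ℝ, ℝ) 𝓘(ℝ, E) ω γ t) :
    ContMDiffAt 𝓘(ℝ, ℝ) 𝓘(ℝ, E) ω (fun s => g • γ s) t :=
  ((hact.2 g).contMDiffAt).comp t h

variable [FiniteDimensional ℝ E] [T2Space M] [IsManifold 𝓘(ℝ, E) ω M]

/-- Transition maps of immersive curves have open domains and are analytic. -/
theorem IsTransCurve.analyticAt_map (hact : IsAnalyticAction F E G M) {γ : ℝ → M} {a : ℝ}
    (hγ : IsTransCurve G γ a) (him : ∀ t ∈ Icc (-a) a, IsImmersedAt E γ t) {g : G} {s : ℝ}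
    (hs : s ∈ Ioo (-a) a) (hacc : AccPt s (𝓟 (transDom γ a g)))
    (hfs : transMap γ a g s ∈ Ioo (-a) a) :
    transDom γ a g ∈ 𝓝 s ∧ AnalyticAt ℝ (transMap γ a g) s := by
  have := FiniteDimensional.complete ℝ E
  have hsD := hγ.mem_dom_of_accPt hacc
  -- Continuity of the transition map turns the accumulation of its domain at `s` into infinitely
  -- many meetings of `g • γ` with arbitrarily short pieces of `γ` around the image parameter.
  obtain ⟨ρ, hρa, hρs, hρ⟩ := exists_analyticAt_reparam (β := γ) (t := transMap γ a g s)
    (hact.contMDiffAt_smul g (him s (Ioo_subset_Icc_self hs)).1)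
    (him _ (Ioo_subset_Icc_self hfs)) (apply_transMap hsD).symm (fun T hT => by
      have h1 : ∀ᶠ u in 𝓝 s, u ∈ transDom γ a g → transMap γ a g u ∈ T :=
        eventually_nhdsWithin_iff.1 ((hγ.continuousOn_map g s hsD).eventually_mem hT)
      have h2 : ∃ᶠ u in 𝓝[≠] s, u ∈ transDom γ a g := accPt_iff_frequently_nhdsNE.1 hacc
      exact (h2.and_eventually (h1.filter_mono nhdsWithin_le_nhds)).mono fun u hu =>
        ⟨_, hu.2 hu.1, apply_transMap hu.1⟩)
  have hmem : ∀ᶠ u in 𝓝 s, ρ u ∈ Ioo (-a) a :=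
    hρa.continuousAt.eventually_mem (by rw [hρs]; exact isOpen_Ioo.mem_nhds hfs)
  have hev : ∀ᶠ u in 𝓝 s, u ∈ transDom γ a g ∧ transMap γ a g u = ρ u := by
    filter_upwards [hρ, hmem, isOpen_Ioo.mem_nhds hs] with u h1 h2 h3
    exact ⟨mem_transDom (Ioo_subset_Icc_self h3) (Ioo_subset_Icc_self h2) h1,
      hγ.map_eq (Ioo_subset_Icc_self h3) (Ioo_subset_Icc_self h2) h1⟩
  exact ⟨hev.mono fun u hu => hu.1, hρa.congr (hev.mono fun u hu => hu.2.symm)⟩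

theorem isOpenTransCurve (hact : IsAnalyticAction F E G M) (hsat : ∀ x : M, IsSated G x)
    {γ : ℝ → M} {a : ℝ} (ha : 0 < a) (hinj : InjOn γ (Icc (-a) a))
    (him : ∀ t ∈ Icc (-a) a, IsImmersedAt E γ t) : IsOpenTransCurve G γ a := by
  have h : IsTransCurve G γ a :=
    { pos := ha
      continuousOn := fun t ht => (him t ht).1.continuousAt.continuousWithinAt
      injOn := hinj
      continuous_smul := fun g => (hact.2 g).continuous
      sated := fun t _ => hsat (γ t) }
  exact ⟨h, fun g s hs hacc hfs => (h.analyticAt_map hact him hs hacc hfs).1⟩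

end Analytic

/-! ### Curves around a point of an immersed 1-manifold -/

/-- `γ : [-a, a] → M` is an injective analytic immersive curve that runs through `ι` near `w`, with
coordinate `e` on `S` centred at `w`; it may extend `ι` beyond a boundary point `w`. -/
structure IsChartCurve (E : Type*) {M S : Type*} [NormedAddCommGroup E] [NormedSpace ℝ E]
    [TopologicalSpace M] [ChartedSpace E M] [TopologicalSpace S] (ι : S → M) (w : S) (γ : ℝ → M)
    (a : ℝ) (e : S → ℝ) : Prop where
  pos : 0 < a
  immersed : ∀ t ∈ Icc (-a) a, IsImmersedAt E γ t
  injOn : InjOn γ (Icc (-a) a)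
  center : e w = 0
  link : ∀ᶠ x in 𝓝 w, ContinuousAt e x ∧ γ (e x) = ι x

namespace IsChartCurve

variable {F E G M S : Type*}
  [NormedAddCommGroup E] [NormedSpace ℝ E] [TopologicalSpace M] [ChartedSpace E M]
  [TopologicalSpace S] {ι : S → M} {w : S} {γ : ℝ → M} {a : ℝ} {e : S → ℝ}

theorem eventually_abs_lt (h : IsChartCurve E ι w γ a e) {r : ℝ} (hr : 0 < r) :
    ∀ᶠ x in 𝓝 w, |e x| < r := by
  have hc : ContinuousAt (fun x => |e x|) w := h.link.self_of_nhds.1.abs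
  refine hc.eventually_mem (s := Iio r) (Iio_mem_nhds ?_)
  rw [h.center, abs_zero]
  exact hr

/-- The coordinates of a neighbourhood of a point close to `w` contain an interval. -/
theorem eventually_exists_Icc_subset [LocallyConnectedSpace S] (hperf : ∀ x : S, (𝓝[≠] x).NeBot)
    (hι : Function.Injective ι) (h : IsChartCurve E ι w γ a e) :
    ∀ᶠ x in 𝓝 w, ∀ V ∈ 𝓝 x, ∃ p q, p < q ∧ Icc p q ⊆ e '' V := by
  filter_upwards [h.link.eventually_nhds] with x hx V hV
  -- A connected neighbourhood has an interval as its set of coordinates, and this is not a single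
  -- point because `x` is not isolated. At a boundary point the interval may lie on one side only.
  obtain ⟨C, ⟨hCo, hxC, hC⟩, hCV⟩ := (LocallyConnectedSpace.open_connected_basis x).mem_iff.1
    (inter_mem hV hx)
  obtain ⟨y, hy, hyx⟩ := ((hperf x).nonempty_of_mem
    (inter_mem (nhdsWithin_le_nhds (hCo.mem_nhds hxC)) self_mem_nhdsWithin))
  have hne : e y ≠ e x := fun heq => hyx (hι (by
    rw [← (hCV hy).2.2, ← (hCV hxC).2.2, heq]))
  have hord : (e '' C).OrdConnected := (hC.isPreconnected.image e fun z hz =>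
    (hCV hz).2.1.continuousWithinAt).ordConnected
  have hsub : e '' C ⊆ e '' V := image_mono fun z hz => (hCV hz).1
  rcases lt_or_gt_of_ne hne with hlt | hlt
  · exact ⟨_, _, hlt, (hord.out (mem_image_of_mem e hy) (mem_image_of_mem e hxC)).trans hsub⟩
  · exact ⟨_, _, hlt, (hord.out (mem_image_of_mem e hxC) (mem_image_of_mem e hy)).trans hsub⟩

variable [Group G] [MulAction G M] [T2Space M]

/-- If `g` moves infinitely many points of a small part of `S` into that part, then `γ` and `g • γ`
meet near the centre. -/
theorem exists_nhds_meets (hγ : IsTransCurve G γ a) (h : IsChartCurve E ι w γ a e) {r : ℝ}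
    (hr : 0 < r) : ∃ V ∈ 𝓝 w, ∀ g : G, (g • (ι '' V) ∩ ι '' V).Infinite → Meets γ a r g := by
  obtain ⟨r', hr', hlt⟩ := exists_between (lt_min hr h.pos)
  obtain ⟨h1, h2⟩ := lt_min_iff.1 hlt
  have hsub : Icc (-r') r' ⊆ Icc (-a) a := Icc_subset_Icc (by linarith) (by linarith)
  refine ⟨_, inter_mem h.link (h.eventually_abs_lt hr'), fun g hinf => ?_⟩
  -- Both the parameter and its image are confined to the compact interval `[-r', r']`, so an
  -- accumulation point of `X` again belongs to `X`, with both values below `r`.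
  set X : Set ℝ := Icc (-r') r' ∩ {s ∈ Icc (-a) a | g • γ s ∈ γ '' (Icc (-a) a ∩ Icc (-r') r')}
  have hX : IsClosed X := isClosed_Icc.inter (hγ.isClosed_setOf_smul_mem g isClosed_Icc)
  have hXinf : X.Infinite := by
    refine Infinite.of_image (fun s => g • γ s) (hinf.mono ?_)
    rintro _ ⟨⟨_, ⟨x, hx, rfl⟩, rfl⟩, ⟨y, hy, hyx⟩⟩
    have hex : e x ∈ Icc (-r') r' := abs_le.1 hx.2.le
    have hey : e y ∈ Icc (-r') r' := abs_le.1 hy.2.le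
    refine ⟨e x, ⟨hex, hsub hex, e y, ⟨hsub hey, hey⟩, ?_⟩, ?_⟩
    · rw [hy.1.2, hx.1.2]; exact hyx
    · simp only [hx.1.2]
  obtain ⟨s, hs, hacc⟩ := hXinf.exists_accPt_of_subset_isCompact isCompact_Icc inter_subset_left
  have hXD : X ⊆ transDom γ a g := fun t ht =>
    ⟨ht.2.1, image_mono inter_subset_left ht.2.2⟩
  have hsX : s ∈ X := isClosed_iff_clusterPt.1 hX s hacc.clusterPt
  refine ⟨s, hacc.mono (principal_mono.2 hXD), (abs_le.2 hs).trans_lt h1, ?_⟩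
  obtain ⟨t, ht, hst⟩ := hsX.2.2
  rw [hγ.map_eq hsX.2.1 ht.1 hst.symm]
  exact (abs_le.2 ht.2).trans_lt h1

end IsChartCurve

/-! ### Sequences of group elements converging along `S` -/

section Propagation

variable {F E G M S : Type*} [NormedAddCommGroup F] [NormedSpace ℝ F]
  [NormedAddCommGroup E] [NormedSpace ℝ E]
  [Group G] [TopologicalSpace M] [ChartedSpace E M] [MulAction G M]
  [TopologicalSpace S]

/-- The points `g n • ι x` converge to `ι x`, and `g n • ι` eventually meets `ι` infinitely often
close to `x`. -/
def ConvergesAt (ι : S → M) (g : ℕ → G) (x : S) : Prop :=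
  Tendsto (fun n => g n • ι x) atTop (𝓝 (ι x)) ∧
    ∀ V ∈ 𝓝 x, ∀ᶠ n in atTop, (g n • (ι '' V) ∩ ι '' V).Infinite

variable [T2Space M] [LocallyConnectedSpace S] {ι : S → M} {w : S} {γ : ℝ → M} {a : ℝ}
  {e : S → ℝ} {g : ℕ → G}

theorem IsChartCurve.eventually_convergesAt (hperf : ∀ x : S, (𝓝[≠] x).NeBot)
    (hι : Function.Injective ι) (hγ : IsTransCurve G γ a) (h : IsChartCurve E ι w γ a e)
    {η : ℝ} (hη : 0 < η) (hηa : η ≤ a)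
    (hD : ∀ᶠ n in atTop, Ioo (-η) η ⊆ transDom γ a (g n))
    (hlim : ∀ u ∈ Ioo (-η) η, Tendsto (fun n => transMap γ a (g n) u) atTop (𝓝 u)) :
    ∀ᶠ x in 𝓝 w, ConvergesAt ι g x := by
  have hsub : Ioo (-η) η ⊆ Icc (-a) a := fun x hx => ⟨by linarith [hx.1], by linarith [hx.2]⟩
  have hev : ∀ᶠ x in 𝓝 w, γ (e x) = ι x ∧ |e x| < η :=
    (h.link.mono fun x hx => hx.2).and (h.eventually_abs_lt hη)
  filter_upwards [hev.eventually_nhds, h.eventually_exists_Icc_subset hperf hι] with x hx hx'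
  constructor
  · have hxI : e x ∈ Ioo (-η) η := abs_lt.1 hx.self_of_nhds.2
    have h1 : Tendsto (fun n => γ (transMap γ a (g n) (e x))) atTop (𝓝 (γ (e x))) :=
      (hγ.continuousOn (e x) (hsub hxI)).tendsto.comp (tendsto_nhdsWithin_iff.2
        ⟨hlim _ hxI, hD.mono fun n hn => transMap_mem (hn hxI)⟩)
    rw [hx.self_of_nhds.1] at h1
    refine h1.congr' (hD.mono fun n hn => ?_)
    rw [apply_transMap (hn hxI), hx.self_of_nhds.1]
  · intro V hV
    obtain ⟨p, q, hpq, hsubV⟩ := hx' _ (inter_mem hV hx)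
    have hI : Icc p q ⊆ Ioo (-η) η := fun t ht => by
      obtain ⟨y, hy, rfl⟩ := hsubV ht
      exact abs_lt.1 hy.2.2
    -- Once the images of `p` and `q` have moved by less than a third of `q - p`, the image of `[p,
    -- q]` covers the middle third, which gives infinitely many common points.
    have hm1 : p < (2 * p + q) / 3 := by linarith
    have hm2 : (p + 2 * q) / 3 < q := by linarith
    filter_upwards [hD, (hlim p (hI ⟨le_rfl, hpq.le⟩)).eventually_mem (Iio_mem_nhds hm1),
      (hlim q (hI ⟨hpq.le, le_rfl⟩)).eventually_mem (Ioi_mem_nhds hm2)] with n hn hp hq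
    exact (hγ.infinite_inter (fun y hy => hy.2.1) hsubV (hI.trans hn)
      (by linarith : (2 * p + q) / 3 < (p + 2 * q) / 3) hm1.le hm2.le (le_of_lt hp)
      (le_of_lt hq)).mono
      (inter_subset_inter (smul_set_mono (image_mono inter_subset_left))
        (image_mono inter_subset_left))

variable [FirstCountableTopology M]

/-- The closedness half of the propagation. Infinitely many common points near some `x` close to `w`
put the transition maps on a uniform interval around `w`. They converge to the identity at two
points of it, hence are eventually increasing, and then converge on the whole interval. -/
theorem IsChartCurve.eventually_convergesAt_of_frequently (hperf : ∀ x : S, (𝓝[≠] x).NeBot)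
    (hι : Function.Injective ι) (hγ : IsOpenTransCurve G γ a) (h : IsChartCurve E ι w γ a e)
    (hfr : ∃ᶠ x in 𝓝 w, ∀ᶠ y in 𝓝 x, ConvergesAt ι g y) :
    ∀ᶠ x in 𝓝 w, ConvergesAt ι g x := by
  obtain ⟨η, hη, hηa, hgood⟩ := hγ.exists_radius hγ.pos le_rfl
  have hsub : Ioo (-η) η ⊆ Icc (-a) a := fun x hx => ⟨by linarith [hx.1], by linarith [hx.2]⟩
  obtain ⟨V, hV, hVm⟩ := h.exists_nhds_meets hγ.toIsTransCurve hη
  have hev : ∀ᶠ x in 𝓝 w, γ (e x) = ι x ∧ |e x| < η :=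
    (h.link.mono fun x hx => hx.2).and (h.eventually_abs_lt hη)
  obtain ⟨x, hx, hVx, hevx, hIcc⟩ := (hfr.and_eventually ((eventually_mem_nhds_iff.2 hV).and
    (hev.eventually_nhds.and (h.eventually_exists_Icc_subset hperf hι)))).exists
  have hD : ∀ᶠ n in atTop, Ioo (-η) η ⊆ transDom γ a (g n) :=
    (hx.self_of_nhds.2 V hVx).mono fun n hn => (hgood _ (hVm _ hn)).1
  obtain ⟨p, q, hpq, hsubV⟩ := hIcc _ (hx.and hevx)
  have hpt : ∀ t ∈ Icc p q, t ∈ Ioo (-η) η ∧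
      Tendsto (fun n => transMap γ a (g n) t) atTop (𝓝 t) := by
    intro t ht
    obtain ⟨y, ⟨hy, hyι, hyη⟩, rfl⟩ := hsubV ht
    have hyI : e y ∈ Ioo (-η) η := abs_lt.1 hyη
    refine ⟨hyI, hγ.tendsto_of_tendsto_comp (hD.mono fun n hn => transMap_mem (hn hyI))
      (hsub hyI) ?_⟩
    rw [hyι]
    refine hy.1.congr' (hD.mono fun n hn => ?_)
    change g n • ι y = γ _
    rw [apply_transMap (hn hyI), hyι]
  obtain ⟨hpI, hplim⟩ := hpt p ⟨le_rfl, hpq.le⟩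
  obtain ⟨hqI, hqlim⟩ := hpt q ⟨hpq.le, le_rfl⟩
  have hmono : ∀ᶠ n in atTop, StrictMonoOn (transMap γ a (g n)) (Ioo (-η) η) := by
    filter_upwards [hD, hplim.eventually_lt hqlim hpq] with n hn hlt
    refine (hγ.strictMonoOn_or_strictAntiOn hη hn).resolve_right fun hanti => ?_
    exact lt_asymm hlt (hanti hpI hqI hpq)
  refine h.eventually_convergesAt hperf hι hγ.toIsTransCurve hη hηa hD fun u hu => ?_
  refine hγ.tendsto_transMap hηa hD hmono hpI (tendsto_const_nhds (x := p)) ?_ hu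
  simpa using hplim.sub_const p

/-- Convergence propagates along the connected space `S`. -/
theorem convergesAt_of_eventually [ConnectedSpace S] (hperf : ∀ x : S, (𝓝[≠] x).NeBot)
    (hι : Function.Injective ι)
    (hch : ∀ w : S, ∃ γ a e, IsOpenTransCurve G γ a ∧ IsChartCurve E ι w γ a e)
    (hw : ∀ᶠ x in 𝓝 w, ConvergesAt ι g x) (x : S) : ConvergesAt ι g x := by
  have hcl : IsClopen {x | ∀ᶠ y in 𝓝 x, ConvergesAt ι g y} := by
    refine ⟨isClosed_iff_frequently.2 fun y hy => ?_, isOpen_setOfPred_eventually_nhds⟩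
    obtain ⟨γ, a, e, hγ, h⟩ := hch y
    exact h.eventually_convergesAt_of_frequently hperf hι hγ hy
  have huniv := hcl.eq_univ ⟨w, hw⟩
  have : x ∈ {x | ∀ᶠ y in 𝓝 x, ConvergesAt ι g y} := huniv ▸ mem_univ x
  exact Eventually.self_of_nhds this

/-- An element outside the stabilizer of a free 1-manifold reverses the orientation wherever it
maps a curve into itself close to a given point. -/
theorem IsChartCurve.exists_strictAntiOn [ConnectedSpace S] (hperf : ∀ x : S, (𝓝[≠] x).NeBot)
    (hι : Function.Injective ι)
    (hch : ∀ w : S, ∃ γ a e, IsOpenTransCurve G γ a ∧ IsChartCurve E ι w γ a e)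
    {H : Subgroup G} {V₀ : Set S} {x₀ : S} (hV₀ : V₀ ∈ 𝓝 x₀)
    (hH : ∀ g : G, (g • (ι '' V₀) ∩ ι '' V₀).Infinite → g ∈ H)
    (hγ : IsOpenTransCurve G γ a) (h : IsChartCurve E ι w γ a e) :
    ∃ ε > 0, ε ≤ a ∧ ∀ g : G, g ∉ H → Meets γ a ε g →
      Ioo (-ε) ε ⊆ transDom γ a g ∧ (∀ x ∈ Ioo (-ε) ε, transMap γ a g x ∈ Ioo (-a) a) ∧
        StrictAntiOn (transMap γ a g) (Ioo (-ε) ε) := by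
  obtain ⟨η, hη, hηa, hgood⟩ := hγ.exists_radius hγ.pos le_rfl
  suffices hs : ∃ ε > 0, ε ≤ η ∧ ∀ g : G, g ∉ H → Meets γ a ε g →
      ¬ StrictMonoOn (transMap γ a g) (Ioo (-η) η) by
    obtain ⟨ε, hε, hεη, hs⟩ := hs
    refine ⟨ε, hε, hεη.trans hηa, fun g hg hm => ?_⟩
    have hsub : Ioo (-ε) ε ⊆ Ioo (-η) η := Ioo_subset_Ioo (by linarith) hεη
    obtain ⟨s, hs1, hs2, hs3⟩ := id hm
    obtain ⟨hD, hb⟩ := hgood g ⟨s, hs1, hs2.trans_le hεη, hs3.trans_le hεη⟩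
    exact ⟨hsub.trans hD, fun x hx => abs_lt.1 (hb x (hsub hx)),
      ((hγ.strictMonoOn_or_strictAntiOn hη hD).resolve_left (hs g hg hm)).mono hsub⟩
  by_contra! hcon
  -- Were the claim false for each `ε`, increasing transition maps of elements outside `H` would
  -- have almost fixed points tending to the centre. They converge to the identity, this reaches
  -- `x₀`, and there the elements must belong to `H`.
  obtain ⟨d, -, hd, hd0⟩ := exists_seq_strictAnti_tendsto' hη
  choose g hgH hgm hgmono using fun n => hcon (d n) (hd n).1 (hd n).2.le
  choose s hsacc hs hfs using hgm
  have hD : ∀ n, Ioo (-η) η ⊆ transDom γ a (g n) := fun n =>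
    (hgood _ ⟨s n, hsacc n, (hs n).trans (hd n).2, (hfs n).trans (hd n).2⟩).1
  have hs0 : Tendsto s atTop (𝓝 0) := squeeze_zero_norm (fun n => (hs n).le) hd0
  have hf0 : Tendsto (fun n => transMap γ a (g n) (s n)) atTop (𝓝 0) :=
    squeeze_zero_norm (fun n => (hfs n).le) hd0
  have hconv := convergesAt_of_eventually hperf hι hch
    (h.eventually_convergesAt hperf hι hγ.toIsTransCurve hη hηa (Eventually.of_forall hD)
      fun u hu => hγ.tendsto_transMap hηa (Eventually.of_forall hD) (Eventually.of_forall hgmono)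
        (σ := 0) ⟨by linarith, hη⟩ hs0 (by simpa using hf0.sub hs0) hu) x₀
  obtain ⟨n, hn⟩ := (hconv.2 V₀ hV₀).exists
  exact hgH n (hH _ hn)

/-- Two elements outside the stabilizer of a free 1-manifold that map a curve into itself close to
a given point have their product in the stabilizer. -/
theorem IsChartCurve.exists_mul_mem [ConnectedSpace S] (hperf : ∀ x : S, (𝓝[≠] x).NeBot)
    (hι : Function.Injective ι)
    (hch : ∀ w : S, ∃ γ a e, IsOpenTransCurve G γ a ∧ IsChartCurve E ι w γ a e)
    {H : Subgroup G} {V₀ : Set S} {x₀ : S} (hV₀ : V₀ ∈ 𝓝 x₀)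
    (hH : ∀ g : G, (g • (ι '' V₀) ∩ ι '' V₀).Infinite → g ∈ H)
    (hγ : IsOpenTransCurve G γ a) (h : IsChartCurve E ι w γ a e) :
    ∃ ε > 0, ε ≤ a ∧ (∀ g : G, g ∉ H → Meets γ a ε g →
      Ioo (-ε) ε ⊆ transDom γ a g ∧ (∀ x ∈ Ioo (-ε) ε, transMap γ a g x ∈ Ioo (-a) a) ∧
        StrictAntiOn (transMap γ a g) (Ioo (-ε) ε)) ∧
      ∀ g h : G, g ∉ H → h ∉ H → Meets γ a ε g → Meets γ a ε h → g * h ∈ H := by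
  obtain ⟨ε, hε, hεa, hanti⟩ := h.exists_strictAntiOn hperf hι hch hV₀ hH hγ
  -- The second, smaller radius keeps the values of the transition map of `g` below `ε`, so that the
  -- product still meets within the radius where the dichotomy is known.
  obtain ⟨η, hη, hηε, hgood⟩ := hγ.exists_radius hε hεa
  have hmeets : ∀ g : G, Meets γ a η g → Meets γ a ε g := fun g ⟨s, h1, h2, h3⟩ =>
    ⟨s, h1, h2.trans_le hηε, h3.trans_le hηε⟩
  have hsub : Ioo (-η) η ⊆ Ioo (-ε) ε := Ioo_subset_Ioo (by linarith) hηε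
  refine ⟨η, hη, hηε.trans hεa, fun g hg hm => ?_, fun g k hg hk hgm hkm => ?_⟩
  · obtain ⟨h1, h2, h3⟩ := hanti g hg (hmeets g hm)
    exact ⟨hsub.trans h1, fun x hx => h2 x (hsub hx), h3.mono hsub⟩
  by_contra hgk
  have hgA := (hanti g hg (hmeets g hgm)).2.2
  have hkA := (hanti k hk (hmeets k hkm)).2.2
  obtain ⟨hgD, hgb⟩ := hgood g hgm
  obtain ⟨hkD, -⟩ := hgood k hkm
  obtain ⟨s, hsacc, hs, hks⟩ := hkm
  have hsI : s ∈ Ioo (-η) η := abs_lt.1 hs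
  have hnear : ∀ᶠ x in 𝓝 s, x ∈ Ioo (-η) η ∧ transMap γ a k x ∈ Ioo (-η) η := by
    have hI := isOpen_Ioo.mem_nhds hsI
    exact Eventually.and hI ((((hγ.continuousOn_map k).mono hkD).continuousAt hI).eventually_mem
      (isOpen_Ioo.mem_nhds (abs_lt.1 hks)))
  have hcomp : ∀ x ∈ Ioo (-η) η, transMap γ a k x ∈ Ioo (-η) η →
      x ∈ transDom γ a (g * k) ∧
        transMap γ a (g * k) x = transMap γ a g (transMap γ a k x) := by
    intro x hx hkx
    have heq : (g * k) • γ x = γ (transMap γ a g (transMap γ a k x)) := by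
      rw [apply_transMap (hgD hkx), apply_transMap (hkD hx), mul_smul]
    exact ⟨mem_transDom (hkD hx).1 (transMap_mem (hgD hkx)) heq,
      hγ.map_eq (hkD hx).1 (transMap_mem (hgD hkx)) heq⟩
  have hacc : AccPt s (𝓟 (transDom γ a (g * k))) :=
    accPt_iff_frequently_nhdsNE.2 ((hnear.filter_mono nhdsWithin_le_nhds).mono fun x hx =>
      (hcomp x hx.1 hx.2).1).frequently
  have hgkm : Meets γ a ε (g * k) := by
    refine ⟨s, hacc, hs.trans_le hηε, ?_⟩
    rw [(hcomp s hsI (abs_lt.1 hks)).2]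
    exact hgb _ (abs_lt.1 hks)
  have hgkA := (hanti (g * k) hgk hgkm).2.2
  -- One pair `s < y` suffices: the composition of two decreasing maps preserves its order, while
  -- the transition map of `g * k ∉ H` would reverse it.
  obtain ⟨y, ⟨hyI, hky⟩, hys⟩ := ((hnear.filter_mono nhdsWithin_le_nhds).and
    (self_mem_nhdsWithin : Ioi s ∈ 𝓝[>] s)).exists
  have h1 := hgkA (hsub hsI) (hsub hyI) hys
  rw [(hcomp s hsI (abs_lt.1 hks)).2, (hcomp y hyI hky).2] at h1
  exact lt_asymm h1 (hgA (hsub hky) (hsub (abs_lt.1 hks)) (hkA (hsub hsI) (hsub hyI) hys))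

end Propagation

/-! ### Charts of a 1-manifold with boundary -/

section Charts

variable {E M S : Type*} [NormedAddCommGroup E] [NormedSpace ℝ E]
  [TopologicalSpace M] [ChartedSpace E M] [TopologicalSpace S]

theorem continuousAt_chartCoord (ψ : OpenPartialHomeomorph S (EuclideanHalfSpace 1)) {z : S}
    (hz : z ∈ ψ.source) : ContinuousAt (chartCoord ψ) z := by
  have h1 : Continuous fun y : EuclideanHalfSpace 1 => y.1 0 :=
    (EuclideanSpace.proj (𝕜 := ℝ) (0 : Fin 1)).continuous.comp continuous_subtype_val
  exact h1.continuousAt.comp (ψ.continuousAt hz)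

theorem extend_eq_chartCoord (ψ : OpenPartialHomeomorph S (EuclideanHalfSpace 1)) (z : S) :
    ψ.extend (𝓡∂ 1) z = !₂[chartCoord ψ z] := by
  ext i
  fin_cases i
  rfl

theorem neBot_nhdsNE_of_chartedSpace [ChartedSpace (EuclideanHalfSpace 1) S] (x : S) :
    (𝓝[≠] x).NeBot := by
  set ψ := chartAt (EuclideanHalfSpace 1) x
  have hx : x ∈ ψ.source := mem_chart_source _ x
  have : Nontrivial (EuclideanHalfSpace 1) := by
    refine ⟨⟨0, by simp⟩, ⟨!₂[1], by simp⟩, fun h => ?_⟩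
    have := congrArg (fun y : EuclideanHalfSpace 1 => y.1 0) h
    simp at this
  have hT1 : T1Space (EuclideanHalfSpace 1) := inferInstanceAs (T1Space (Subtype _))
  have hne : (𝓝[≠] (ψ x)).NeBot := ConnectedSpace.neBot_nhdsWithin_compl_of_nontrivial_of_t1space _
  rw [← mem_closure_iff_nhdsWithin_neBot, mem_closure_iff_nhds] at hne ⊢
  intro U hU
  have hU' : ψ.symm ⁻¹' U ∩ ψ.target ∈ 𝓝 (ψ x) := inter_mem
    ((ψ.continuousAt_symm (ψ.map_source hx)).preimage_mem_nhds (by rwa [ψ.left_inv hx]))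
    (ψ.open_target.mem_nhds (ψ.map_source hx))
  obtain ⟨y, ⟨hyU, hyt⟩, hy⟩ := hne _ hU'
  refine ⟨ψ.symm y, hyU, fun h => hy ?_⟩
  have h' : ψ.symm y = x := h
  change y = ψ x
  rw [← h', ψ.right_inv hyt]

theorem tendsto_chartCoord_nhdsNE {M : Type*} {ι : S → M} (hι : Function.Injective ι)
    (ψ : OpenPartialHomeomorph S (EuclideanHalfSpace 1)) {x : S} (hx : x ∈ ψ.source) :
    Tendsto (chartCoord ψ) (𝓝[≠] x) (𝓝[≠] (chartCoord ψ x)) := by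
  refine tendsto_nhdsWithin_iff.2
    ⟨(continuousAt_chartCoord ψ hx).tendsto.mono_left nhdsWithin_le_nhds, ?_⟩
  filter_upwards [nhdsWithin_le_nhds (ψ.open_source.mem_nhds hx), self_mem_nhdsWithin] with y hy hyx h
  refine hyx (hι ?_)
  rw [← chartCurve_chartCoord ι ψ hy, ← chartCurve_chartCoord ι ψ hx]
  exact congrArg _ h

theorem IsImmersedAt.comp_const_add {δ : ℝ → M} {τ t : ℝ} (h : IsImmersedAt E δ (τ + t)) :
    IsImmersedAt E (fun s => δ (τ + s)) t := by
  have hT : ContMDiffAt 𝓘(ℝ, ℝ) 𝓘(ℝ, ℝ) ω (fun s : ℝ => τ + s) t :=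
    contMDiffAt_iff_contDiffAt.2 (contDiffAt_const.add contDiffAt_id)
  refine ⟨ContMDiffAt.comp (g := δ) t h.1 hT, ?_⟩
  have hc : mfderiv 𝓘(ℝ, ℝ) 𝓘(ℝ, E) (δ ∘ fun s => τ + s) t = _ :=
    mfderiv_comp t (h.1.mdifferentiableAt (by simp)) (hT.mdifferentiableAt (by simp))
  change Function.Injective (mfderiv 𝓘(ℝ, ℝ) 𝓘(ℝ, E) (δ ∘ fun s => τ + s) t)
  rw [hc]
  have hid : mfderiv 𝓘(ℝ, ℝ) 𝓘(ℝ, ℝ) (fun s : ℝ => τ + s) t = ContinuousLinearMap.id ℝ ℝ := by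
    rw [mfderiv_eq_fderiv, fderiv_const_add]
    exact fderiv_id
  rw [hid]
  exact h.2

/-- An immersive extension of `ι` near a point, shifted and restricted to a short interval. -/
theorem exists_isChartCurve [IsManifold 𝓘(ℝ, E) ω M] [CompleteSpace E] {ι : S → M}
    {ψ : OpenPartialHomeomorph S (EuclideanHalfSpace 1)} {w : S} (hw : w ∈ ψ.source)
    {δ : ℝ → M} {I : Set ℝ} (hI : I ∈ 𝓝 (chartCoord ψ w)) (hδ : ∀ t ∈ I, IsImmersedAt E δ t)
    (hlink : ∀ᶠ x in 𝓝 w, δ (chartCoord ψ x) = ι x) :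
    ∃ a, (∀ t ∈ Icc (-a) a, chartCoord ψ w + t ∈ I) ∧
      IsChartCurve E ι w (fun t => δ (chartCoord ψ w + t)) a
        (fun x => chartCoord ψ x - chartCoord ψ w) := by
  set τ := chartCoord ψ w
  obtain ⟨U, hU, hUinj⟩ := (hδ τ (mem_of_mem_nhds hI)).eventually_injOn
  obtain ⟨r, hr, hball⟩ := Metric.mem_nhds_iff.1 (inter_mem hI hU)
  have hmem : ∀ t ∈ Icc (-(r / 2)) (r / 2), τ + t ∈ I ∩ U := fun t ht => hball (by
    rw [Metric.mem_ball, Real.dist_eq, add_sub_cancel_left]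
    exact (abs_le.2 ht).trans_lt (by linarith))
  refine ⟨r / 2, fun t ht => (hmem t ht).1, by positivity,
    fun t ht => (hδ _ (hmem t ht).1).comp_const_add, ?_, sub_self _, ?_⟩
  · intro s hs t ht hst
    exact add_left_cancel (hUinj (hmem s hs).2 (hmem t ht).2 hst)
  · filter_upwards [hlink, ψ.open_source.mem_nhds hw] with x hx hxs
    refine ⟨(continuousAt_chartCoord ψ hxs).sub continuousAt_const, ?_⟩
    rw [add_sub_cancel]
    exact hx

/-- Near every point, `ι` has an analytic immersive extension in some admissible chart. -/
theorem exists_immersiveExtension [FiniteDimensional ℝ E] [IsManifold 𝓘(ℝ, E) ω M]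
    [ChartedSpace (EuclideanHalfSpace 1) S] [IsManifold (𝓡∂ 1) ω S]
    {ι : S → M} (hι : IsInjectiveImmersion E ι) (z : S) :
    ∃ ψ : OpenPartialHomeomorph S (EuclideanHalfSpace 1), IsAdmissibleChart E ι ψ ∧
      z ∈ ψ.source ∧ ∃ δ I, IsImmersiveExtension E (chartCurve ι ψ) (chartRange ψ) δ I := by
  have : CompleteSpace E := FiniteDimensional.complete ℝ E
  have : LocallyConnectedSpace S := ChartedSpace.locallyConnectedSpace (EuclideanHalfSpace 1) S
  set ψ₀ := chartAt (EuclideanHalfSpace 1) z with hψ₀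
  have hz : z ∈ ψ₀.source := mem_chart_source _ z
  set φ := extChartAt 𝓘(ℝ, E) (ι z) with hφ
  set τ := chartCoord ψ₀ z with hτ
  set p : EuclideanSpace ℝ (Fin 1) := extChartAt (𝓡∂ 1) z z with hp
  have hpτ : p = !₂[τ] := extend_eq_chartCoord ψ₀ z
  obtain ⟨hcont, hdiff⟩ := contMDiffAt_iff.1 (hι.2.1 z)
  -- Analyticity on the half-line, even at its end, yields an analytic function on a full
  -- neighbourhood. This provides the extension beyond a boundary point.
  obtain ⟨Γ, hΓeq, hΓa⟩ := analyticWithinAt_iff_exists_analyticAt.1 hdiff.analyticWithinAt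
  have hpr : p ∈ range (𝓡∂ 1) := mem_range_self (ψ₀ z)
  rw [insert_eq_of_mem hpr] at hΓeq
  -- the derivative of `Γ` is that of `ι`
  have hΓinj : Function.Injective (fderiv ℝ Γ p) := by
    have h1 := hι.2.2 z
    rw [((hι.2.1 z).mdifferentiableAt (by simp)).mfderiv] at h1
    have h2 : fderivWithin ℝ (writtenInExtChartAt (𝓡∂ 1) 𝓘(ℝ, E) z ι) (range (𝓡∂ 1)) p =
        fderiv ℝ Γ p := by
      rw [← hΓa.differentiableAt.fderivWithin ((𝓡∂ 1).uniqueDiffWithinAt_image (x := ψ₀ z))]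
      exact hΓeq.fderivWithin_eq (hΓeq.self_of_nhdsWithin hpr)
    rwa [h2] at h1
  set v : EuclideanSpace ℝ (Fin 1) := !₂[1] with hv
  have hL : ∀ t : ℝ, (!₂[t] : EuclideanSpace ℝ (Fin 1)) = t • v := fun t => by
    ext i; fin_cases i; simp [hv]
  set β : ℝ → E := fun t => Γ (t • v) with hβ
  have hpv : τ • v = p := by rw [hpτ, hL]
  have hΓa' : AnalyticAt ℝ Γ (τ • v) := by rw [hpv]; exact hΓa
  have hβa : AnalyticAt ℝ β τ :=
    AnalyticAt.comp (f := fun t : ℝ => t • v) hΓa' (analyticAt_id.smul analyticAt_const)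
  have hβd : deriv β τ ≠ 0 := by
    have hd : HasDerivAt (fun t : ℝ => t • v) v τ := by
      simpa using (hasDerivAt_id τ).smul_const v
    have h1 : HasDerivAt β (fderiv ℝ Γ (τ • v) v) τ :=
      hΓa'.differentiableAt.hasFDerivAt.comp_hasDerivAt τ hd
    rw [h1.deriv, hpv]
    intro h0
    have hv0 : v = 0 := hΓinj (h0.trans (map_zero _).symm)
    have := congrArg (fun y : EuclideanSpace ℝ (Fin 1) => y 0) hv0
    simp [hv] at this
  have hβτ : β τ = φ (ι z) := by
    have h1 := hΓeq.self_of_nhdsWithin hpr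
    change Γ (τ • v) = _
    rw [hpv, ← h1]
    simp only [Function.comp_apply, extChartAt_to_inv, hφ]
  have hev : ∀ᶠ t in 𝓝 τ, AnalyticAt ℝ β t ∧ deriv β t ≠ 0 ∧ β t ∈ φ.target := by
    refine hβa.eventually_analyticAt.and ((hβa.deriv.continuousAt.eventually_ne hβd).and
      (hβa.continuousAt.eventually_mem ?_))
    rw [hβτ]
    exact extChartAt_target_mem_nhds (ι z)
  obtain ⟨r, hr, hball⟩ := Metric.eventually_nhds_iff_ball.1 hev
  rw [Real.ball_eq_Ioo] at hball
  set I := Ioo (τ - r) (τ + r) with hIdef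
  have hτI : τ ∈ I := ⟨by linarith, by linarith⟩
  have hnear : ∀ᶠ x in 𝓝 z, x ∈ ψ₀.source ∧ ι x ∈ (chartAt E (ι z)).source ∧
      chartCoord ψ₀ x ∈ I ∧ β (chartCoord ψ₀ x) = φ (ι x) := by
    have h1 : Tendsto (extChartAt (𝓡∂ 1) z) (𝓝 z) (𝓝[range (𝓡∂ 1)] p) :=
      tendsto_nhdsWithin_iff.2 ⟨(continuousAt_extChartAt z).tendsto,
        Eventually.of_forall fun x => mem_range_self (ψ₀ x)⟩
    filter_upwards [ψ₀.open_source.mem_nhds hz,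
      hcont.eventually_mem ((chartAt E (ι z)).open_source.mem_nhds (mem_chart_source E _)),
      (continuousAt_chartCoord ψ₀ hz).eventually_mem (isOpen_Ioo.mem_nhds hτI),
      h1.eventually hΓeq] with x hx1 hx2 hx3 hx4
    refine ⟨hx1, hx2, hx3, ?_⟩
    have hx5 : extChartAt (𝓡∂ 1) z x = chartCoord ψ₀ x • v := by
      rw [← hL]; exact extend_eq_chartCoord ψ₀ x
    have hx6 : (extChartAt (𝓡∂ 1) z).symm (extChartAt (𝓡∂ 1) z x) = x :=
      (extChartAt (𝓡∂ 1) z).left_inv (by rwa [extChartAt_source])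
    change Γ (chartCoord ψ₀ x • v) = _
    rw [← hx5, ← hx4]
    simp only [Function.comp_apply, hx6, hφ]
  -- The chart is cut down to a connected neighbourhood on which the extension agrees with `ι` and
  -- the image stays in one chart of `M`.
  obtain ⟨U, ⟨hUo, hzU, hUc⟩, hU⟩ :=
    (LocallyConnectedSpace.open_connected_basis z).mem_iff.1 hnear
  have hsrc : (ψ₀.restr U).source = U := by
    rw [ψ₀.restr_source' U hUo]
    exact inter_eq_right.2 fun x hx => (hU hx).1
  have hφs : ∀ x ∈ U, φ.symm (φ (ι x)) = ι x := fun x hx =>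
    φ.left_inv (by rw [hφ, extChartAt_source]; exact (hU hx).2.1)
  refine ⟨ψ₀.restr U, ⟨restr_mem_maximalAtlas _
    (IsManifold.chart_mem_maximalAtlas z) hUo, by rwa [hsrc], chartAt E (ι z),
    IsManifold.chart_mem_maximalAtlas _, ?_⟩, by rwa [hsrc], fun t => φ.symm (β t), I,
    ⟨⟨isOpen_Ioo, ordConnected_Ioo, ⟨τ, hτI⟩⟩, ?_, ?_, ?_⟩, ?_⟩
  · rw [hsrc]
    rintro _ ⟨x, hx, rfl⟩
    exact (hU hx).2.1
  · rintro _ ⟨x, hx, rfl⟩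
    rw [hsrc] at hx
    exact (hU hx).2.2.1
  · rintro _ ⟨x, hx, rfl⟩
    rw [chartCurve_chartCoord ι _ hx]
    rw [hsrc] at hx
    change φ.symm (β (chartCoord ψ₀ x)) = ι x
    rw [(hU hx).2.2.2, hφs x hx]
  · intro t ht
    have h1 : ContMDiffAt 𝓘(ℝ, ℝ) 𝓘(ℝ, E) ω β t :=
      contMDiffAt_iff_contDiffAt.2 (hball t ht).1.contDiffAt
    have h2 : ContMDiffAt 𝓘(ℝ, E) 𝓘(ℝ, E) ω φ.symm (β t) :=
      (contMDiffOn_extChartAt_symm (ι z)).contMDiffAt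
        ((isOpen_extChartAt_target (ι z)).mem_nhds (hball t ht).2.2)
    exact (h2.comp t h1).contMDiffWithinAt
  · intro t ht
    have h1 : ContMDiffAt 𝓘(ℝ, ℝ) 𝓘(ℝ, E) ω β t :=
      contMDiffAt_iff_contDiffAt.2 (hball t ht).1.contDiffAt
    have h2 : ContMDiffAt 𝓘(ℝ, E) 𝓘(ℝ, E) ω φ.symm (β t) :=
      (contMDiffOn_extChartAt_symm (ι z)).contMDiffAt
        ((isOpen_extChartAt_target (ι z)).mem_nhds (hball t ht).2.2)
    have h3 : ContMDiffAt 𝓘(ℝ, ℝ) 𝓘(ℝ, E) ω (fun t => φ.symm (β t)) t := h2.comp t h1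
    have hmemt : φ.symm (β t) ∈ (chartAt E (ι z)).source := by
      have := φ.map_target (hball t ht).2.2
      rwa [hφ, extChartAt_source] at this
    have hφd : MDifferentiableAt 𝓘(ℝ, E) 𝓘(ℝ, E) φ (φ.symm (β t)) :=
      mdifferentiableAt_extChartAt hmemt
    have hcomp := mfderiv_comp t hφd (h3.mdifferentiableAt (by simp))
    have heq : (φ ∘ fun t => φ.symm (β t)) =ᶠ[𝓝 t] β := by
      filter_upwards [isOpen_Ioo.mem_nhds ht] with u hu using φ.right_inv (hball u hu).2.2
    rw [heq.mfderiv_eq, mfderiv_eq_fderiv] at hcomp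
    have hβinj : Function.Injective (fderiv ℝ β t) := by
      refine (injective_iff_map_eq_zero _).2 fun c hc => ?_
      have h4 : fderiv ℝ β t c = c • deriv β t := by
        rw [← fderiv_apply_one_eq_deriv, ← map_smul, smul_eq_mul, mul_one]
      exact (smul_eq_zero.1 (h4.symm.trans hc)).resolve_right (hball t ht).2.1
    rw [hcomp] at hβinj
    exact Function.Injective.of_comp (f := mfderiv 𝓘(ℝ, E) 𝓘(ℝ, E) φ (φ.symm (β t))) hβinj

end Charts

/-! ### Stabilizers, free segments and flip points -/

section Free

variable {F E G M S : Type*}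
  [NormedAddCommGroup F] [NormedSpace ℝ F]
  [NormedAddCommGroup E] [NormedSpace ℝ E] [FiniteDimensional ℝ E]
  [Group G] [TopologicalSpace M] [ChartedSpace E M] [IsManifold 𝓘(ℝ, E) ω M] [MulAction G M]
  [TopologicalSpace S]
  {ι : S → M} {w : S} {γ : ℝ → M} {a : ℝ} {e : S → ℝ}

/-- In a curve around `w`, a flip point close to `w` is a fixed point of a transition map. -/
theorem IsChartCurve.eventually_flipPoints [ChartedSpace (EuclideanHalfSpace 1) S]
    (hperf : ∀ x : S, (𝓝[≠] x).NeBot)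
    (hι : Function.Injective ι) (h : IsChartCurve E ι w γ a e) :
    ∀ᶠ x in 𝓝 w, x ∈ flipPoints G E ι → ∃ g : G, g ∉ imageStabilizer G ι ∧
      AccPt (e x) (𝓟 (transDom γ a g)) ∧ g • γ (e x) = γ (e x) := by
  have := FiniteDimensional.complete ℝ E
  filter_upwards [h.link.eventually_nhds, h.eventually_abs_lt h.pos] with x hx hxa
  rintro ⟨ψ, -, hxψ, δ, I, ⟨⟨⟨hIo, -, -⟩, hψI, hδψ, hsm⟩, himm⟩, g, hg, J, ⟨hJo, -, -⟩, hJI, hτJ,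
    -, -, ρ, ⟨hbij, ρ', σ, I₁, I₂, -, -, hI₁, -, hρeq, -, -, -, hρa, -⟩, hρτ, hρ⟩
  set τ := chartCoord ψ x
  have hδ : ∀ t ∈ I, IsImmersedAt E δ t := fun t ht =>
    ⟨(hsm t ht).contMDiffAt (hIo.mem_nhds ht), himm t ht⟩
  have hτI : τ ∈ I := hJI hτJ
  have hδι : ∀ y ∈ ψ.source, δ (chartCoord ψ y) = ι y := fun y hy => by
    rw [hδψ (mem_image_of_mem _ hy), chartCurve_chartCoord ι ψ hy]
  have hxe : γ (e x) = ι x := hx.self_of_nhds.2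
  have hxa' : e x ∈ Ioo (-a) a := abs_lt.1 hxa
  -- The flip is given in another chart with its own extension `δ`. Since `δ` and `γ` both run
  -- through `ι` near `x`, they differ by an analytic change of parameter `θ`, possibly beyond the
  -- boundary.
  obtain ⟨θ, hθa, hθτ, hθ⟩ := exists_analyticAt_reparam (E := E) (hδ τ hτI).1
    (h.immersed _ (Ioo_subset_Icc_self hxa')) ((hδι x hxψ).trans hxe.symm) (fun T hT => by
      refine (tendsto_chartCoord_nhdsNE hι ψ hxψ).frequently
        (Eventually.frequently (f := 𝓝[≠] x) ?_)
      refine Eventually.filter_mono nhdsWithin_le_nhds ?_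
      filter_upwards [hx, ψ.open_source.mem_nhds hxψ,
        hx.self_of_nhds.1.eventually_mem hT] with y hy hyψ hyT
      exact ⟨e y, hyT, by rw [hδι y hyψ, hy.2]⟩)
  obtain ⟨U, hU, hUinj⟩ := (hδ τ hτI).eventually_injOn
  have hτD : τ ∈ Iic τ ∩ J := ⟨mem_Iic.2 le_rfl, hτJ⟩
  have hρ'τ : ρ' τ = τ := (hρeq hτD).trans hρτ
  have hρ't : Tendsto ρ' (𝓝 τ) (𝓝 τ) := by
    have := (hρa τ (hI₁ hτD)).continuousAt.tendsto
    rwa [hρ'τ] at this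
  have hθI : ∀ᶠ u in 𝓝 τ, θ u ∈ Ioo (-a) a :=
    hθa.continuousAt.eventually_mem (by rw [hθτ]; exact isOpen_Ioo.mem_nhds hxa')
  have hgτ : g • γ (e x) = γ (e x) := by
    rw [hxe, ← hδι x hxψ]
    have := hρ τ hτD
    rwa [hρτ] at this
  refine ⟨g, hg, accPt_iff_frequently_nhdsNE.2 ?_, hgτ⟩
  -- Only parameters `u < τ` are available, as `ρ` is given on the left half. Local injectivity of
  -- `δ` keeps `θ u` away from `e x`, so a genuine accumulation point results.
  have hθtend : Tendsto θ (𝓝[<] τ) (𝓝[≠] (e x)) := by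
    refine tendsto_nhdsWithin_iff.2 ⟨?_, ?_⟩
    · have := hθa.continuousAt.tendsto
      rw [hθτ] at this
      exact this.mono_left nhdsWithin_le_nhds
    · filter_upwards [nhdsWithin_le_nhds hU, nhdsWithin_le_nhds hθ, self_mem_nhdsWithin]
        with u hu hθu hlt heq
      refine (ne_of_lt hlt) (hUinj hu (mem_of_mem_nhds hU) ?_)
      have heq' : θ u = e x := heq
      rw [hθu, heq', hxe, hδι x hxψ]
  refine hθtend.frequently (Eventually.frequently ?_)
  filter_upwards [nhdsWithin_le_nhds hθ, nhdsWithin_le_nhds hθI, self_mem_nhdsWithin,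
    nhdsWithin_le_nhds (hJo.mem_nhds hτJ), nhdsWithin_le_nhds (hρ't.eventually hθ),
    nhdsWithin_le_nhds (hρ't.eventually hθI)] with u h1 h2 h3 h4 h5 h6
  have huD : u ∈ Iic τ ∩ J := ⟨mem_Iic.2 (le_of_lt h3), h4⟩
  refine mem_transDom (Ioo_subset_Icc_self h2) (Ioo_subset_Icc_self h6) ?_
  rw [← h1, ← h5, hρeq huD]
  exact hρ u huD

variable [TopologicalSpace G] [ChartedSpace F G] [T2Space M]

/-- If `g` fixes a curve near some point, then it fixes the whole curve. -/
theorem IsChartCurve.smul_eq_of_frequently [LocallyConnectedSpace S]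
    (hact : IsAnalyticAction F E G M) (hperf : ∀ x : S, (𝓝[≠] x).NeBot)
    (hι : Function.Injective ι) (h : IsChartCurve E ι w γ a e) {g : G}
    (hg : ∃ᶠ x in 𝓝 w, ∀ᶠ y in 𝓝 x, g • ι y = ι y) :
    ∀ t ∈ Icc (-a) a, g • γ t = γ t := by
  have := FiniteDimensional.complete ℝ E
  obtain ⟨x, hx, hx', hIcc⟩ := (hg.and_eventually (((h.link.mono fun x hx => hx.2).and
    (h.eventually_abs_lt h.pos)).eventually_nhds.and
      (h.eventually_exists_Icc_subset hperf hι))).exists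
  obtain ⟨p, q, hpq, hsub⟩ := hIcc _ (hx.and hx')
  have hpt : ∀ t ∈ Icc p q, t ∈ Icc (-a) a ∧ g • γ t = γ t := by
    intro t ht
    obtain ⟨y, ⟨hy, hyι, hya⟩, rfl⟩ := hsub ht
    exact ⟨abs_le.1 hya.le, by rw [hyι, hy]⟩
  have hp := hpt p ⟨le_rfl, hpq.le⟩
  refine eqOn_of_frequently_eq (s := p) isPreconnected_Icc
    (fun s hs => hact.contMDiffAt_smul g (h.immersed s hs).1) (fun s hs => (h.immersed s hs).1)
    hp.1 ?_
  have hev : ∀ᶠ u in 𝓝[>] p, g • γ u = γ u := by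
    filter_upwards [Ioo_mem_nhdsGT hpq] with u hu using (hpt u (Ioo_subset_Icc_self hu)).2
  exact hev.frequently.filter_mono (nhdsWithin_mono p fun u hu => ne_of_gt hu)

/-- Needed because `γ` may leave `ι(S)` past a boundary point; the identity theorem carries the
fixing over to that part. -/
theorem IsChartCurve.smul_eq_of_mem_imageStabilizer [LocallyConnectedSpace S]
    (hact : IsAnalyticAction F E G M) (hperf : ∀ x : S, (𝓝[≠] x).NeBot)
    (hι : Function.Injective ι) (h : IsChartCurve E ι w γ a e) {g : G}
    (hg : g ∈ imageStabilizer G ι) : ∀ t ∈ Icc (-a) a, g • γ t = γ t := by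
  have hg' : ∀ x, g • ι x = ι x := fun x => (Subgroup.mem_iInf.1 hg x)
  exact h.smul_eq_of_frequently hact hperf hι
    (Eventually.of_forall fun x => Eventually.of_forall hg').frequently

/-- The points near which `g` fixes `ι` form a clopen set, closedness being the identity theorem
along a chart curve; `S` is connected. -/
theorem mem_imageStabilizer_of_eventually [LocallyConnectedSpace S] [ConnectedSpace S]
    (hact : IsAnalyticAction F E G M) (hperf : ∀ x : S, (𝓝[≠] x).NeBot)
    (hι : Function.Injective ι) (hch : ∀ w : S, ∃ γ a e, IsChartCurve E ι w γ a e) {g : G}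
    (hg : ∀ᶠ y in 𝓝 w, g • ι y = ι y) : g ∈ imageStabilizer G ι := by
  have hcl : IsClopen {x | ∀ᶠ y in 𝓝 x, g • ι y = ι y} := by
    refine ⟨isClosed_iff_frequently.2 fun x hx => ?_, isOpen_setOfPred_eventually_nhds⟩
    obtain ⟨γ, a, e, h⟩ := hch x
    have heq := h.smul_eq_of_frequently hact hperf hι hx
    change ∀ᶠ y in 𝓝 x, g • ι y = ι y
    filter_upwards [h.link, h.eventually_abs_lt h.pos] with y hy hya
    rw [← hy.2, heq _ (abs_le.1 hya.le)]
  have huniv := hcl.eq_univ ⟨w, hg⟩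
  refine Subgroup.mem_iInf.2 fun x => ?_
  have : x ∈ {x | ∀ᶠ y in 𝓝 x, g • ι y = ι y} := huniv ▸ mem_univ x
  exact Eventually.self_of_nhds (p := fun y => g • ι y = ι y) this

theorem isEmbedding_domRestrict {β : ℝ → M} {J K : Set ℝ} (hK : IsCompact K)
    (hc : ContinuousOn β K) (hi : InjOn β K) (hJK : J ⊆ K) : IsEmbedding (J.domRestrict β) := by
  have : CompactSpace K := isCompact_iff_compactSpace.1 hK
  have hemb : IsEmbedding (K.domRestrict β) :=
    (Continuous.isClosedEmbedding (continuousOn_iff_continuous_domRestrict.1 hc)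
      (injOn_iff_injective.1 hi)).isEmbedding
  exact hemb.comp (IsEmbedding.inclusion hJK)

/-- If `γ` and `g • γ` meet, then they overlap. -/
theorem IsTransCurve.overlap_of_meets (hact : IsAnalyticAction F E G M)
    (hγ : IsTransCurve G γ a) (him : ∀ t ∈ Icc (-a) a, IsImmersedAt E γ t) {g : G}
    (hm : Meets γ a a g) {κ : ℝ → M} {D : Set ℝ} {d : ℝ}
    (hD : ∀ t ∈ Icc (-a) a, d + t ∈ D) (hκ : ∀ t ∈ Icc (-a) a, κ (d + t) = γ t) :
    Overlap (fun t => g • κ t) D κ D := by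
  obtain ⟨s, hacc, hs, hfs⟩ := hm
  set f := transMap γ a g
  have hsI : s ∈ Ioo (-a) a := abs_lt.1 hs
  have hfsI : f s ∈ Ioo (-a) a := abs_lt.1 hfs
  obtain ⟨hDs, hfa⟩ := hγ.analyticAt_map hact him hsI hacc hfsI
  obtain ⟨r, hr, hball⟩ := Metric.nhds_basis_closedBall.mem_iff.1
    (inter_mem hDs (hfa.continuousAt (isOpen_Ioo.mem_nhds hfsI)))
  rw [Real.closedBall_eq_Icc] at hball
  have hdom : Icc (s - r) (s + r) ⊆ transDom γ a g := fun x hx => (hball hx).1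
  have hcont : ContinuousOn f (Icc (s - r) (s + r)) := (hγ.continuousOn_map g).mono hdom
  -- A continuous injective function on an interval is strictly monotone, so it maps the open
  -- interval onto an open interval, as the definition of overlap demands.
  have himg : ∃ c c', c < c' ∧ f '' Ioo (s - r) (s + r) = Ioo c c' := by
    have hle : s - r ≤ s + r := by linarith
    have hlt : s - r < s + r := by linarith
    rcases hcont.strictMonoOn_of_injOn_Icc' hle ((hγ.map_injOn g).mono hdom) with hmono | hanti
    · exact ⟨_, _, hmono ⟨le_rfl, hle⟩ ⟨hle, le_rfl⟩ hlt,
        hcont.image_Ioo_of_strictMonoOn hle hmono⟩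
    · exact ⟨_, _, hanti ⟨le_rfl, hle⟩ ⟨hle, le_rfl⟩ hlt,
        hcont.image_Ioo_of_strictAntiOn hle hanti⟩
  obtain ⟨c, c', hcc, himg⟩ := himg
  have hcsub : Ioo c c' ⊆ Icc (-a) a := by
    rw [← himg]
    rintro _ ⟨x, hx, rfl⟩
    exact transMap_mem (hdom (Ioo_subset_Icc_self hx))
  have hshift : ∀ t ∈ Icc (d - a) (d + a), t - d ∈ Icc (-a) a := fun t ht =>
    ⟨by linarith [ht.1], by linarith [ht.2]⟩
  have hκ' : ∀ t ∈ Icc (d - a) (d + a), κ t = γ (t - d) := fun t ht => by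
    rw [← hκ _ (hshift t ht), add_sub_cancel]
  have hκc : ContinuousOn κ (Icc (d - a) (d + a)) :=
    (hγ.continuousOn.comp (continuousOn_id.sub continuousOn_const) hshift).congr hκ'
  have hκi : InjOn κ (Icc (d - a) (d + a)) := fun t ht u hu htu => by
    rw [hκ' t ht, hκ' u hu] at htu
    exact sub_left_injective (hγ.injOn (hshift t ht) (hshift u hu) htu)
  have hJ : Ioo (d + (s - r)) (d + (s + r)) ⊆ Icc (d - a) (d + a) := fun t ht => by
    have := (hdom (show t - d ∈ Icc (s - r) (s + r) from
      ⟨by linarith [ht.1], by linarith [ht.2]⟩)).1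
    exact ⟨by linarith [this.1], by linarith [this.2]⟩
  have hJ' : Ioo (d + c) (d + c') ⊆ Icc (d - a) (d + a) := fun t ht => by
    have := hcsub (show t - d ∈ Ioo c c' from ⟨by linarith [ht.1], by linarith [ht.2]⟩)
    exact ⟨by linarith [this.1], by linarith [this.2]⟩
  have hDsub : Icc (d - a) (d + a) ⊆ D := fun t ht => by
    have := hD _ (hshift t ht)
    rwa [add_sub_cancel] at this
  refine ⟨_, _, ⟨isOpen_Ioo, ordConnected_Ioo, nonempty_Ioo.2 (by linarith)⟩,
    ⟨isOpen_Ioo, ordConnected_Ioo, nonempty_Ioo.2 (by linarith)⟩, hJ.trans hDsub, hJ'.trans hDsub,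
    isEmbedding_domRestrict isCompact_Icc ((hγ.continuous_smul g).comp_continuousOn hκc)
      ((MulAction.injective g).comp_injOn hκi) hJ,
    isEmbedding_domRestrict isCompact_Icc hκc hκi hJ', ?_⟩
  have key : ∀ t ∈ Ioo (s - r) (s + r), g • κ (d + t) = κ (d + f t) := fun t ht => by
    have htD := hdom (Ioo_subset_Icc_self ht)
    rw [hκ t htD.1, hκ (f t) (transMap_mem htD), apply_transMap htD]
  ext y
  constructor
  · rintro ⟨t, ht, rfl⟩
    have ht' : t - d ∈ Ioo (s - r) (s + r) := ⟨by linarith [ht.1], by linarith [ht.2]⟩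
    have hf : f (t - d) ∈ Ioo c c' := himg ▸ mem_image_of_mem f ht'
    refine ⟨d + f (t - d), ⟨by linarith [hf.1], by linarith [hf.2]⟩, ?_⟩
    rw [← key _ ht', add_sub_cancel]
  · rintro ⟨t, ht, rfl⟩
    have ht' : t - d ∈ f '' Ioo (s - r) (s + r) := himg ▸
      (show t - d ∈ Ioo c c' from ⟨by linarith [ht.1], by linarith [ht.2]⟩)
    obtain ⟨u, hu, hut⟩ := ht'
    refine ⟨d + u, ⟨by linarith [hu.1], by linarith [hu.2]⟩, ?_⟩
    change g • κ (d + u) = κ t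
    rw [key u hu, hut, add_sub_cancel]

/-- A free 1-manifold has a non-empty open part such that each element of the group that maps
infinitely many of its points into it belongs to the stabilizer of the manifold. -/
theorem IsFreeSubmanifold.exists_nhds [ChartedSpace (EuclideanHalfSpace 1) S]
    [LocallyConnectedSpace S] [ConnectedSpace S]
    (hact : IsAnalyticAction F E G M) (hsat : ∀ x : M, IsSated G x)
    (hperf : ∀ x : S, (𝓝[≠] x).NeBot)
    (hι : Function.Injective ι) (hch : ∀ w : S, ∃ γ a e, IsChartCurve E ι w γ a e)
    (hfree : IsFreeSubmanifold G E ι) :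
    ∃ x₀ : S, ∃ V₀ ∈ 𝓝 x₀, ∀ g : G, (g • (ι '' V₀) ∩ ι '' V₀).Infinite →
      g ∈ imageStabilizer G ι := by
  have := FiniteDimensional.complete ℝ E
  obtain ⟨ψ, -, -, D, hDψ, hD, ⟨-, δ, I, ⟨⟨⟨hIo, -, -⟩, hDI, hδ, hsm⟩, himm⟩⟩, hseg⟩ := hfree
  obtain ⟨d, hd⟩ := hD.2
  obtain ⟨w, hw, rfl⟩ := hDψ (interior_subset hd)
  have hDn : interior D ∈ 𝓝 (chartCoord ψ w) := isOpen_interior.mem_nhds hd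
  have hnear : ∀ᶠ x in 𝓝 w, x ∈ ψ.source ∧ chartCoord ψ x ∈ interior D :=
    Eventually.and (ψ.open_source.mem_nhds hw)
      ((continuousAt_chartCoord ψ hw).eventually_mem hDn)
  obtain ⟨a, haD, h⟩ := exists_isChartCurve hw hDn (δ := δ) (ι := ι) (E := E)
    (fun t ht => ⟨(hsm t (hDI (interior_subset ht))).contMDiffAt
      (hIo.mem_nhds (hDI (interior_subset ht))), himm t (hDI (interior_subset ht))⟩)
    (hnear.mono fun x hx => by
      rw [hδ (interior_subset hx.2), chartCurve_chartCoord ι ψ hx.1])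
  have hγ := (isOpenTransCurve hact hsat h.pos h.injOn h.immersed).toIsTransCurve
  obtain ⟨V, hV, hVm⟩ := h.exists_nhds_meets hγ h.pos
  refine ⟨w, V, hV, fun g hg => ?_⟩
  -- Infinitely many returns make the free segment overlap its translate. Hence `g` fixes the
  -- segment, therefore a neighbourhood of `w`, and therefore all of `ι`.
  have hov := hγ.overlap_of_meets hact h.immersed (hVm g hg) (κ := chartCurve ι ψ) (D := D)
    (d := chartCoord ψ w) (fun t ht => interior_subset (haD t ht))
    (fun t ht => (hδ (interior_subset (haD t ht))).symm)
  have hfix := hseg g hov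
  refine mem_imageStabilizer_of_eventually hact hperf hι hch (w := w) ?_
  filter_upwards [hnear] with x hx
  rw [← chartCurve_chartCoord ι ψ hx.1]
  exact hfix _ (interior_subset hx.2)

/-- A decreasing transition map that fixes the centre of the curve makes the centre a flip
point. -/
theorem mem_flipPoints [ChartedSpace (EuclideanHalfSpace 1) S]
    (hact : IsAnalyticAction F E G M) {ψ : OpenPartialHomeomorph S (EuclideanHalfSpace 1)}
    (hψ : IsAdmissibleChart E ι ψ) (hw : w ∈ ψ.source) {δ : ℝ → M} {I : Set ℝ}
    (hδ : IsImmersiveExtension E (chartCurve ι ψ) (chartRange ψ) δ I)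
    (haI : ∀ t ∈ Icc (-a) a, chartCoord ψ w + t ∈ I)
    (him : ∀ t ∈ Icc (-a) a, IsImmersedAt E (fun t => δ (chartCoord ψ w + t)) t)
    (hγ : IsTransCurve G (fun t => δ (chartCoord ψ w + t)) a) {g : G}
    (hg : g ∉ imageStabilizer G ι) {ε : ℝ} (hε : 0 < ε)
    (hD : Ioo (-ε) ε ⊆ transDom (fun t => δ (chartCoord ψ w + t)) a g)
    (hfa : ∀ x ∈ Ioo (-ε) ε, transMap (fun t => δ (chartCoord ψ w + t)) a g x ∈ Ioo (-a) a)
    (hanti : StrictAntiOn (transMap (fun t => δ (chartCoord ψ w + t)) a g) (Ioo (-ε) ε))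
    (hf0 : transMap (fun t => δ (chartCoord ψ w + t)) a g 0 = 0) : w ∈ flipPoints G E ι := by
  set τ := chartCoord ψ w
  set γ : ℝ → M := fun t => δ (τ + t) with hγdef
  set f := transMap γ a g
  -- Halving `ε` makes `f` available at the endpoints `± c` themselves.
  set c := ε / 2
  have hc : 0 < c := by positivity
  have hlt : c < ε := half_lt_self hε
  have hcε : Icc (-c) c ⊆ Ioo (-ε) ε := fun x hx => ⟨by linarith [hx.1], by linarith [hx.2]⟩
  have hcont : ContinuousOn f (Icc (-c) c) := (hγ.continuousOn_map g).mono (hcε.trans hD)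
  have hanti' : StrictAntiOn f (Icc (-c) c) := hanti.mono hcε
  have hmc : -c ∈ Icc (-c) c := ⟨le_rfl, by linarith⟩
  have hpc : c ∈ Icc (-c) c := ⟨by linarith, le_rfl⟩
  have h0c : (0 : ℝ) ∈ Icc (-c) c := ⟨by linarith, hc.le⟩
  have hb : 0 < f (-c) := by
    have := hanti' hmc h0c (by linarith)
    rwa [hf0] at this
  have hb' : f c < f (-c) := hanti' hmc hpc (by linarith)
  have hba : f (-c) < a := (hfa _ (hcε hmc)).2
  have hca : -a ≤ -c := (hD (hcε hmc)).1.1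
  have himg : f '' Ioo (-c) c = Ioo (f c) (f (-c)) :=
    hcont.image_Ioo_of_strictAntiOn (by linarith) hanti'
  have hIoo : Ioo (-c) c ⊆ Icc (-c) c := Ioo_subset_Icc_self
  have hinvdom : Ioo (f c) (f (-c)) ⊆ transDom γ a g⁻¹ := by
    rw [← himg]
    rintro _ ⟨x, hx, rfl⟩
    exact transMap_mem_transDom_inv (hD (hcε (hIoo hx)))
  have hshift : ∀ {p q t : ℝ}, t ∈ Ioo (τ + p) (τ + q) ↔ t - τ ∈ Ioo p q := by
    intro p q t
    constructor
    · exact fun ht => ⟨by linarith [ht.1], by linarith [ht.2]⟩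
    · exact fun ht => ⟨by linarith [ht.1], by linarith [ht.2]⟩
  have hsubAn : ∀ t : ℝ, AnalyticAt ℝ (fun x : ℝ => x - τ) t := fun t =>
    analyticAt_id.sub analyticAt_const
  have hleft : ∀ t ∈ Iic τ ∩ Ioo (τ + -c) (τ + f (-c)), t - τ ∈ Ioc (-c) 0 := fun t ht =>
    ⟨(hshift.1 ht.2).1, sub_nonpos.2 ht.1⟩
  -- Since `f` is decreasing with `f 0 = 0`, it maps `(-c, 0]` onto `[0, f (-c))`; this dictates the
  -- asymmetric `J`. The analytic extension of the flip is the same formula on `(τ - c, τ + c)`,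
  -- inverted by the transition map of `g⁻¹`.
  refine ⟨ψ, hψ, hw, δ, I, hδ, g, hg, Ioo (τ + -c) (τ + f (-c)),
    ⟨isOpen_Ioo, ordConnected_Ioo, ⟨τ, by linarith, by linarith⟩⟩, ?_,
    ⟨by linarith, by linarith⟩, ⟨mem_Iic.2 le_rfl, by linarith, by linarith⟩,
    ⟨mem_Ici.2 le_rfl, by linarith, by linarith⟩, fun t => τ + f (t - τ), ⟨⟨?_, ?_, ?_⟩,
      fun t => τ + f (t - τ), fun t => τ + transMap γ a g⁻¹ (t - τ), Ioo (τ + -c) (τ + c),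
      Ioo (τ + f c) (τ + f (-c)), ⟨isOpen_Ioo, ordConnected_Ioo, ⟨τ, by linarith, by linarith⟩⟩,
      ⟨isOpen_Ioo, ordConnected_Ioo, nonempty_Ioo.2 (by linarith)⟩, ?_, ?_, fun _ _ => rfl,
      ?_, ?_, ⟨?_, ?_⟩, ?_, ?_⟩, ?_, ?_⟩
  · intro t ht
    have := haI (t - τ) ⟨by linarith [ht.1], by linarith [ht.2]⟩
    rwa [add_sub_cancel] at this
  · intro t ht
    have ht' := hleft t ht
    have hI : t - τ ∈ Icc (-c) c := ⟨ht'.1.le, ht'.2.trans hc.le⟩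
    have h1 := hanti' hmc hI ht'.1
    have h2 := hanti'.antitoneOn hI h0c ht'.2
    rw [hf0] at h2
    exact ⟨by change τ ≤ τ + f (t - τ); linarith, by change τ + -c < τ + f (t - τ); linarith,
      by change τ + f (t - τ) < τ + f (-c); linarith⟩
  · intro t ht u hu htu
    have hI : ∀ t ∈ Iic τ ∩ Ioo (τ + -c) (τ + f (-c)), t - τ ∈ Icc (-c) c := fun t ht =>
      ⟨(hleft t ht).1.le, (hleft t ht).2.trans hc.le⟩
    exact sub_left_injective (hanti'.injOn (hI t ht) (hI u hu) (add_left_cancel htu))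
  · rintro t ⟨ht, ht'⟩
    have ht'' := hshift.1 ht'
    have h0t : 0 ≤ t - τ := sub_nonneg.2 ht
    obtain ⟨x, hx, hxt⟩ := intermediate_value_Icc' (f := f) (by linarith : -c ≤ 0)
      (hcont.mono (Icc_subset_Icc_right hc.le)) ⟨by rw [hf0]; exact h0t, ht''.2.le⟩
    have hxc : x ≠ -c := by
      rintro rfl
      exact ht''.2.ne hxt.symm
    have hxc' : -c < x := lt_of_le_of_ne hx.1 hxc.symm
    refine ⟨τ + x, ⟨by change τ + x ≤ τ; linarith [hx.2], by linarith, by linarith [hx.2]⟩, ?_⟩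
    simp only [add_sub_cancel_left, hxt, add_sub_cancel]
  · intro t ht
    have ht' := hleft t ht
    exact hshift.2 ⟨ht'.1, ht'.2.trans_lt hc⟩
  · rintro t ⟨ht, ht'⟩
    have hfc : f c < 0 := by
      have := hanti' h0c hpc hc
      rwa [hf0] at this
    have ht'' : τ ≤ t := ht
    exact ⟨by linarith, ht'.2⟩
  · intro t ht
    refine hshift.2 ?_
    rw [add_sub_cancel_left, ← himg]
    exact mem_image_of_mem f (hshift.1 ht)
  · intro t ht
    have ht' := hshift.1 ht
    rw [← himg] at ht'
    obtain ⟨x, hx, hxt⟩ := ht'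
    refine hshift.2 ?_
    rw [add_sub_cancel_left, ← hxt, hγ.map_inv_map (hD (hcε (hIoo hx)))]
    exact hx
  · intro t ht
    have ht' := hshift.1 ht
    simp only [add_sub_cancel_left]
    rw [hγ.map_inv_map (hD (hcε (hIoo ht'))), add_sub_cancel]
  · intro t ht
    have ht' := hshift.1 ht
    rw [← himg] at ht'
    obtain ⟨x, hx, hxt⟩ := ht'
    simp only [add_sub_cancel_left]
    rw [← hxt, hγ.map_inv_map (hD (hcε (hIoo hx)))]
    change τ + f x = t
    rw [hxt, add_sub_cancel]
  · intro t ht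
    have ht' := hshift.1 ht
    have hxa := hcε (hIoo ht')
    have hacc : AccPt (t - τ) (𝓟 (transDom γ a g)) :=
      (isPreconnected_Ioo.preperfect_of_nontrivial ⟨_, hcε hmc, _, hcε hpc, by linarith⟩ _
        hxa).mono (principal_mono.2 hD)
    have hfan := (hγ.analyticAt_map hact him (s := t - τ) ?_ hacc (hfa _ hxa)).2
    · exact analyticAt_const.add (AnalyticAt.comp (g := f) (f := fun x : ℝ => x - τ) hfan
        (hsubAn t))
    · have := (hD (hcε hpc)).1.2
      exact ⟨by linarith [ht'.1], by linarith [ht'.2]⟩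
  · intro t ht
    have ht' := hshift.1 ht
    have hacc : AccPt (t - τ) (𝓟 (transDom γ a g⁻¹)) := by
      obtain ⟨m, hm1, hm2⟩ := exists_between ht'.2
      exact (isPreconnected_Ioo.preperfect_of_nontrivial
        ⟨_, ht', m, ⟨ht'.1.trans hm1, hm2⟩, hm1.ne⟩ _ ht').mono (principal_mono.2 hinvdom)
    rw [← himg] at ht'
    obtain ⟨x, hx, hxt⟩ := ht'
    have hxε := hcε (hIoo hx)
    have hpa := (hD (hcε hpc)).1.2
    have hfan := (hγ.analyticAt_map hact him (s := t - τ) ?_ hacc ?_).2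
    · exact analyticAt_const.add (AnalyticAt.comp (g := transMap γ a g⁻¹)
        (f := fun x : ℝ => x - τ) hfan (hsubAn t))
    · rw [← hxt]; exact hfa _ hxε
    · rw [← hxt, hγ.map_inv_map (hD hxε)]
      exact ⟨by linarith [hx.1], by linarith [hx.2]⟩
  · change τ + f (τ - τ) = τ
    rw [sub_self, hf0, add_zero]
  · intro t ht
    have ht' := hleft t ht
    have hI : t - τ ∈ Icc (-c) c := ⟨ht'.1.le, ht'.2.trans hc.le⟩
    have := apply_transMap (hD (hcε hI))
    simp only [hγdef, add_sub_cancel] at this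
    exact this.symm

end Free

/-- A flip fixes a point of `M`, so under a free action it is the identity, which lies in every
stabilizer. -/
theorem flipPoints_eq_empty {E G M S : Type*} [NormedAddCommGroup E] [NormedSpace ℝ E] [Group G]
    [TopologicalSpace M] [ChartedSpace E M] [MulAction G M] [TopologicalSpace S]
    [ChartedSpace (EuclideanHalfSpace 1) S] {ι : S → M} (hfree : IsFreeAction G M) : flipPoints G E ι = ∅ := by
  refine eq_empty_iff_forall_notMem.2 ?_
  rintro z ⟨ψ, -, -, δ, I, -, g, hg, J, -, -, -, ht, -, ρ, -, hρ, heq⟩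
  refine hg ?_
  have hfix : g ∈ MulAction.stabilizer G (δ (chartCoord ψ z)) := by
    have := heq _ ht
    rwa [hρ] at this
  rw [hfree, Subgroup.mem_bot] at hfix
  rw [hfix]
  exact one_mem _

/-! ### Uniqueness of the local transition map, countability and finiteness -/

section Main

variable {F E G M S : Type*}
  [NormedAddCommGroup F] [NormedSpace ℝ F]
  [NormedAddCommGroup E] [NormedSpace ℝ E] [FiniteDimensional ℝ E]
  [TopologicalSpace G] [ChartedSpace F G] [Group G]
  [TopologicalSpace M] [ChartedSpace E M] [IsManifold 𝓘(ℝ, E) ω M] [MulAction G M]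
  [TopologicalSpace S] {ι : S → M}

/-- The element `g⁻¹ * k = (g * g)⁻¹ * (g * k)` lies in the stabilizer, hence fixes the curve. -/
theorem IsChartCurve.smul_eq_of_mul_mem [T2Space M] [LocallyConnectedSpace S]
    (hact : IsAnalyticAction F E G M)
    (hperf : ∀ x : S, (𝓝[≠] x).NeBot) (hι : Function.Injective ι)
    {w : S} {γ : ℝ → M} {a : ℝ} {e : S → ℝ} (h : IsChartCurve E ι w γ a e) {g k : G}
    (hgg : g * g ∈ imageStabilizer G ι) (hgk : g * k ∈ imageStabilizer G ι) :
    ∀ t ∈ Icc (-a) a, k • γ t = g • γ t := by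
  intro t ht
  have hmem : g⁻¹ * k ∈ imageStabilizer G ι := by
    have := mul_mem (inv_mem hgg) hgk
    rwa [mul_inv_rev, mul_assoc, inv_mul_cancel_left] at this
  have hfix := h.smul_eq_of_mem_imageStabilizer hact hperf hι hmem t ht
  rw [mul_smul, inv_smul_eq_iff] at hfix
  exact hfix

variable [ChartedSpace (EuclideanHalfSpace 1) S] [IsManifold (𝓡∂ 1) ω S]

/-- Every point of `S` is the centre of a chart curve that extends `ι` beyond the boundary. -/
theorem exists_isChartCurve_of_immersion (hι : IsInjectiveImmersion E ι) (w : S) :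
    ∃ ψ : OpenPartialHomeomorph S (EuclideanHalfSpace 1), IsAdmissibleChart E ι ψ ∧
      w ∈ ψ.source ∧ ∃ δ I a, IsImmersiveExtension E (chartCurve ι ψ) (chartRange ψ) δ I ∧
        (∀ t ∈ Icc (-a) a, chartCoord ψ w + t ∈ I) ∧
        IsChartCurve E ι w (fun t => δ (chartCoord ψ w + t)) a
          (fun x => chartCoord ψ x - chartCoord ψ w) := by
  have := FiniteDimensional.complete ℝ E
  obtain ⟨ψ, hψ, hw, δ, I, hδ⟩ := exists_immersiveExtension hι w
  have hI := hδ.1.1.1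
  obtain ⟨a, ha, h⟩ := exists_isChartCurve hw
    (hI.mem_nhds (hδ.1.2.1 (mem_image_of_mem _ hw))) (ι := ι) (E := E)
    (fun t ht => ⟨(hδ.1.2.2.2 t ht).contMDiffAt (hI.mem_nhds ht), hδ.2 t ht⟩)
    (by
      filter_upwards [ψ.open_source.mem_nhds hw] with x hx
      rw [hδ.1.2.2.1 (mem_image_of_mem _ hx), chartCurve_chartCoord ι ψ hx])
  exact ⟨ψ, hψ, hw, δ, I, a, hδ, ha, h⟩

variable [T2Space M] [SecondCountableTopology M] [ConnectedSpace S]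

/-- Near the centre of a chart curve, all elements outside the stabilizer that map the curve into
itself act on it by one and the same decreasing transition map. -/
theorem IsChartCurve.exists_unique_transition [LocallyConnectedSpace S]
    (hact : IsAnalyticAction F E G M) (hι : IsInjectiveImmersion E ι)
    (hsat : ∀ x : M, IsSated G x) (hfree : IsFreeSubmanifold G E ι)
    {w : S} {γ : ℝ → M} {a : ℝ} {e : S → ℝ} (h : IsChartCurve E ι w γ a e) :
    ∃ ε > 0, ε ≤ a ∧ (∀ g : G, g ∉ imageStabilizer G ι → Meets γ a ε g →
      Ioo (-ε) ε ⊆ transDom γ a g ∧ (∀ x ∈ Ioo (-ε) ε, transMap γ a g x ∈ Ioo (-a) a) ∧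
        StrictAntiOn (transMap γ a g) (Ioo (-ε) ε)) ∧
      ∀ g k : G, g ∉ imageStabilizer G ι → k ∉ imageStabilizer G ι → Meets γ a ε g →
        Meets γ a ε k → ∀ t ∈ Icc (-a) a, k • γ t = g • γ t := by
  have hperf : ∀ x : S, (𝓝[≠] x).NeBot := neBot_nhdsNE_of_chartedSpace
  have hch : ∀ w : S, ∃ γ a e, IsChartCurve E ι w γ a e := fun w => by
    obtain ⟨ψ, -, -, δ, I, a, -, -, h⟩ := exists_isChartCurve_of_immersion hι w
    exact ⟨_, _, _, h⟩
  have hopen : ∀ {w : S} {γ : ℝ → M} {a : ℝ} {e : S → ℝ}, IsChartCurve E ι w γ a e →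
      IsOpenTransCurve G γ a := fun h =>
    isOpenTransCurve hact hsat h.pos h.injOn h.immersed
  obtain ⟨x₀, V₀, hV₀, hH⟩ := hfree.exists_nhds hact hsat hperf hι.1 hch
  obtain ⟨ε, hε, hεa, h1, h2⟩ := h.exists_mul_mem hperf hι.1 (fun w => by
    obtain ⟨γ, a, e, h⟩ := hch w
    exact ⟨γ, a, e, hopen h, h⟩) hV₀ hH (hopen h)
  exact ⟨ε, hε, hεa, h1, fun g k hg hk hgm hkm => h.smul_eq_of_mul_mem hact hperf hι.1
    (h2 g g hg hg hgm hgm) (h2 g k hg hk hgm hkm)⟩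

/-- Near each point all flips share one decreasing transition map, whose single possible fixed point
is the only candidate. Second countability of `S` reduces the claim to this local one. -/
theorem countable_flipPoints [LocallyConnectedSpace S] [SecondCountableTopology S]
    (hact : IsAnalyticAction F E G M) (hι : IsInjectiveImmersion E ι)
    (hsat : ∀ x : M, IsSated G x) (hfree : IsFreeSubmanifold G E ι) :
    (flipPoints G E ι).Countable := by
  suffices hloc : ∀ w : S, ∃ V ∈ 𝓝 w, (V ∩ flipPoints G E ι).Subsingleton by
    choose V hV hVs using hloc
    obtain ⟨s, hs, hsU⟩ := TopologicalSpace.countable_cover_nhds hV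
    refine (hs.biUnion fun x _ => (hVs x).countable).mono fun z hz => ?_
    have hzU : z ∈ ⋃ x ∈ s, V x := hsU ▸ mem_univ z
    simp only [mem_iUnion] at hzU ⊢
    obtain ⟨x, hx, hzx⟩ := hzU
    exact ⟨x, hx, hzx, hz⟩
  intro w
  obtain ⟨ψ, -, -, δ, I, a, -, -, h⟩ := exists_isChartCurve_of_immersion hι w
  have hγ := isOpenTransCurve hact hsat h.pos h.injOn h.immersed
  obtain ⟨ε, hε, hεa, h1, h2⟩ := h.exists_unique_transition hact hι hsat hfree
  refine ⟨_, inter_mem (h.link) (inter_mem (h.eventually_abs_lt hε) (h.eventually_flipPoints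
    (G := G) neBot_nhdsNE_of_chartedSpace hι.1)), ?_⟩
  set γ : ℝ → M := fun t => δ (chartCoord ψ w + t)
  set e : S → ℝ := fun x => chartCoord ψ x - chartCoord ψ w
  have hmap : ∀ (g : G) (t : ℝ), |t| < ε → g • γ t = γ t → transMap γ a g t = t := by
    intro g t ht hg
    have htI : t ∈ Icc (-a) a := abs_le.1 (ht.le.trans hεa)
    exact hγ.map_eq htI htI hg
  rintro x ⟨⟨hx, hxε, hxf⟩, hxF⟩ y ⟨⟨hy, hyε, hyf⟩, hyF⟩
  obtain ⟨g, hg, hgacc, hgx⟩ := hxf hxF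
  obtain ⟨k, hk, hkacc, hky⟩ := hyf hyF
  have hxε' : |e x| < ε := hxε
  have hyε' : |e y| < ε := hyε
  have hfx := hmap g (e x) hxε' hgx
  have hgm : Meets γ a ε g := ⟨e x, hgacc, hxε', by rwa [hfx]⟩
  have hkm : Meets γ a ε k := ⟨e y, hkacc, hyε', by rwa [hmap k (e y) hyε' hky]⟩
  -- The two flips act alike on the curve, so both parameters are fixed by the transition map of
  -- `g`.
  have hgy : g • γ (e y) = γ (e y) := by
    rw [← h2 g k hg hk hgm hkm _ (abs_le.1 (hyε'.le.trans hεa)), hky]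
  have hfy := hmap g (e y) hyε' hgy
  have hanti := (h1 g hg hgm).2.2
  refine hι.1 ?_
  rw [← hx.2, ← hy.2]
  change γ (e x) = γ (e y)
  congr 1
  rcases lt_trichotomy (e x) (e y) with hlt | heq | hlt
  · have := hanti (abs_lt.1 hxε') (abs_lt.1 hyε') hlt
    rw [hfx, hfy] at this
    exact absurd this hlt.asymm
  · exact heq
  · have := hanti (abs_lt.1 hyε') (abs_lt.1 hxε') hlt
    rw [hfx, hfy] at this
    exact absurd this hlt.asymm

/-- If all neighbourhoods of `z` fail, elements outside the stabilizer meet the curve at arbitrarily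
small scales. They share one transition map, which by continuity fixes the centre and so makes `z` a
flip point. -/
theorem exists_nhds_finite_inter [LocallyConnectedSpace S]
    (hact : IsAnalyticAction F E G M) (hι : IsInjectiveImmersion E ι)
    (hsat : ∀ x : M, IsSated G x) (hfree : IsFreeSubmanifold G E ι) {z : S}
    (hz : z ∉ flipPoints G E ι) :
    ∃ V ∈ 𝓝 z, ∀ g : G, g ∉ imageStabilizer G ι → (g • (ι '' V) ∩ ι '' V).Finite := by
  by_contra! hcon
  obtain ⟨ψ, hψ, hw, δ, I, a, hδ, haI, h⟩ := exists_isChartCurve_of_immersion hι z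
  have hγ := isOpenTransCurve hact hsat h.pos h.injOn h.immersed
  obtain ⟨ε, hε, hεa, h1, h2⟩ := h.exists_unique_transition hact hι hsat hfree
  have hmeet : ∀ r > 0, ∃ g : G, g ∉ imageStabilizer G ι ∧
      Meets (fun t => δ (chartCoord ψ z + t)) a r g := by
    intro r hr
    obtain ⟨V, hV, hVm⟩ := h.exists_nhds_meets hγ.toIsTransCurve hr
    obtain ⟨g, hg, hinf⟩ := hcon V hV
    exact ⟨g, hg, hVm g hinf⟩
  obtain ⟨g, hg, hgm⟩ := hmeet ε hε
  obtain ⟨hD, hfa, hanti⟩ := h1 g hg hgm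
  refine hz (mem_flipPoints hact hψ hw hδ haI h.immersed hγ.toIsTransCurve hg hε hD hfa hanti ?_)
  set γ : ℝ → M := fun t => δ (chartCoord ψ z + t)
  have h0 : (0 : ℝ) ∈ Ioo (-ε) ε := ⟨by linarith, hε⟩
  obtain ⟨d, -, hd, hd0⟩ := exists_seq_strictAnti_tendsto' hε
  choose k hk hkm using fun n => hmeet (d n) (hd n).1
  choose s hsacc hs hfs using hkm
  have hs0 : Tendsto s atTop (𝓝 0) := squeeze_zero_norm (fun n => (hs n).le) hd0
  have hf0 : Tendsto (fun n => transMap γ a g (s n)) atTop (𝓝 0) := by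
    refine squeeze_zero_norm (fun n => ?_) hd0
    have hsI : s n ∈ Icc (-a) a := abs_le.1 (((hs n).trans (hd n).2).le.trans hεa)
    -- The elements `k n` vary with the scale but act on the curve like the fixed `g`, so their
    -- small values are values of one continuous map.
    have heq : transMap γ a g (s n) = transMap γ a (k n) (s n) := by
      unfold transMap
      rw [h2 g (k n) hg (hk n) hgm ⟨s n, hsacc n, (hs n).trans (hd n).2,
        (hfs n).trans (hd n).2⟩ (s n) hsI]
    rw [heq]
    exact (hfs n).le
  have hcont : ContinuousAt (transMap γ a g) 0 :=
    ((hγ.continuousOn_map g).mono hD).continuousAt (isOpen_Ioo.mem_nhds h0)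
  exact tendsto_nhds_unique (hcont.tendsto.comp hs0) hf0

end Main

end AnalyticCurves

open AnalyticCurves in
theorem mainTheorem9 {F E G M S : Type*}
    [NormedAddCommGroup F] [NormedSpace ℝ F] [FiniteDimensional ℝ F]
    [NormedAddCommGroup E] [NormedSpace ℝ E] [FiniteDimensional ℝ E]
    [TopologicalSpace G] [T2Space G] [SecondCountableTopology G] [ChartedSpace F G]
    [Group G] [LieGroup 𝓘(ℝ, F) ω G]
    [TopologicalSpace M] [T2Space M] [SecondCountableTopology M] [ChartedSpace E M]
    [IsManifold 𝓘(ℝ, E) ω M]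
    [MulAction G M] (hact : IsAnalyticAction F E G M)
    [TopologicalSpace S] [T2Space S] [SecondCountableTopology S]
    [ChartedSpace (EuclideanHalfSpace 1) S] [IsManifold (𝓡∂ 1) ω S] [ConnectedSpace S]
    (ι : S → M) (hι : IsInjectiveImmersion E ι)
    (hreg : IsRegularAction G M) (hfree : IsFreeSubmanifold G E ι) :
    (flipPoints G E ι).Countable ∧
    (IsFreeAction G M → flipPoints G E ι = ∅) ∧
    ∀ z : S, z ∉ flipPoints G E ι →
      ∃ V ∈ 𝓝 z, ∀ g : G, g ∉ imageStabilizer G ι → (g • (ι '' V) ∩ ι '' V).Finite := by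
  have : LocallyConnectedSpace S := ChartedSpace.locallyConnectedSpace (EuclideanHalfSpace 1) S
  have hsat : ∀ x : M, IsSated G x := fun x => (hreg x).1
  exact ⟨countable_flipPoints hact hι hsat hfree, flipPoints_eq_empty,
    fun z hz => exists_nhds_finite_inter hact hι hsat hfree hz⟩
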